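/- Let $n\ge 2$ and $1<p<\infty$. Let $F:\mathbb R^n\to[0,\infty)$ be a convex function with $F(t\xi)=|t|F(\xi)$ for all $t\in\mathbb R$, $\xi\in\mathbb R^n$, and $F(\xi)\ge a|\xi|$ for some constant $a>0$; assume that $F\in C^2(\mathbb R^n\setminus\{0\})$ and that the Hessian of $F^p$ is positive definite at every point of $\mathbb R^n\setminus\{0\}$. Let $F^o(v)=\sup_{\xi\ne 0}\langle \xi,v\rangle/F(\xi)$ be the polar of $F$, and for $r>0$ let $\mathcal W_r=\{\xi\in\mathbb R^n: F^o(\xi)<r\}$ be the Wulff shape of radius $r$ centred at the origin. For a nonempty bounded open convex set $\Omega\subset\mathbb R^n$ with outward unit normal $\nu$ (defined $\mathcal H^{n-1}$-a.e. on $\partial\Omega$) and Lebesgue measure $V(\Omega)$, put $$P_F(\Omega)=\int_{\partial\Omega}F(\nu)\,d\mathcal H^{n-1},\qquad M_F(\Omega)=\int_{\partial\Omega}F^o(x)^p\,F(\nu(x))\,d\mathcal H^{n-1}(x),$$ $$\mathcal F(\Omega)=\frac{M_F(\Omega)}{P_F(\Omega)\,V(\Omega)^{p/n}},\qquad E_F(\Omega)=\Big(\max_{x\in\overline\Omega}F^o(x)\Big)^{p-1}-\frac{M_F(\Omega)}{n\,V(\Omega)}.$$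 If $E_F(\Omega)=0$, then $\Omega=\mathcal W_r$ for some $r>0$, or $\Omega$ is not a minimizer of $\mathcal F$ among all nonempty bounded open convex subsets of $\mathbb R^n$. -/

import Mathlib

open MeasureTheory Set
open scoped RealInnerProductSpace

noncomputable section

namespace AnisotropicMomentum

/-- Finsler norms `F` on `ℝⁿ` for the exponent `p`: convex, nonnegative, absolutely homogeneous,
bounded below by a positive multiple of the Euclidean norm, of class `C²` off the origin, and with
the Hessian of `F ^ p` positive definite off the origin. -/
structure IsFinslerNorm {n : ℕ} (p : ℝ) (F : EuclideanSpace ℝ (Fin n) → ℝ) : Prop where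
  nonneg : ∀ ξ, 0 ≤ F ξ
  convexOn : ConvexOn ℝ univ F
  homogeneous : ∀ (t : ℝ) (ξ : EuclideanSpace ℝ (Fin n)), F (t • ξ) = |t| * F ξ
  lower_bound : ∃ a : ℝ, 0 < a ∧ ∀ ξ, a * ‖ξ‖ ≤ F ξ
  contDiffOn : ContDiffOn ℝ 2 F {0}ᶜ
  hessian_pos : ∀ ξ : EuclideanSpace ℝ (Fin n), ξ ≠ 0 → ∀ v : EuclideanSpace ℝ (Fin n), v ≠ 0 →
    0 < fderiv ℝ (fun x => fderiv ℝ (fun y => F y ^ p) x) ξ v v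

/-- The polar function `F°(v) = sup_{ξ ≠ 0} ⟨ξ, v⟩ / F(ξ)`. -/
def polar {n : ℕ} (F : EuclideanSpace ℝ (Fin n) → ℝ) (v : EuclideanSpace ℝ (Fin n)) : ℝ :=
  ⨆ ξ : {ξ : EuclideanSpace ℝ (Fin n) // ξ ≠ 0}, ⟪(ξ : EuclideanSpace ℝ (Fin n)), v⟫ / F ξ

/-- The Wulff shape of radius `r` centred at `x₀`. -/
def wulffShape {n : ℕ} (F : EuclideanSpace ℝ (Fin n) → ℝ) (r : ℝ)
    (x₀ : EuclideanSpace ℝ (Fin n)) : Set (EuclideanSpace ℝ (Fin n)) :=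
  {ξ | polar F (ξ - x₀) < r}

/-- `ν` is a unit outward normal at `x` to the convex set `Ω`: a unit vector for which the
half-space `{y | ⟨ν, y - x⟩ ≤ 0}` contains `Ω`. -/
def IsOutwardUnitNormal {n : ℕ} (Ω : Set (EuclideanSpace ℝ (Fin n)))
    (x ν : EuclideanSpace ℝ (Fin n)) : Prop :=
  ‖ν‖ = 1 ∧ ∀ y ∈ Ω, ⟪ν, y - x⟫ ≤ 0

open Classical in
/-- The outward unit normal of a convex set `Ω` at the boundary point `x`. The boundary of a convex
open set is differentiable at `x` exactly when there is only one unit outward normal at `x`; this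
holds at almost every boundary point. At the other points the value is `0`. -/
def outwardNormal {n : ℕ} (Ω : Set (EuclideanSpace ℝ (Fin n)))
    (x : EuclideanSpace ℝ (Fin n)) : EuclideanSpace ℝ (Fin n) :=
  if h : ∃! ν, IsOutwardUnitNormal Ω x ν then h.choose else 0

/-- The volume `V(Ω)`. -/
def vol {n : ℕ} (Ω : Set (EuclideanSpace ℝ (Fin n))) : ℝ :=
  (volume Ω).toReal

/-- The anisotropic perimeter `P_F(Ω) = ∫_{∂Ω} F(ν) dℋⁿ⁻¹`. Here `μHE[n - 1]` is the Hausdorff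
measure in the usual normalization, which agrees with Lebesgue measure in dimension `n - 1`. -/
def anisotropicPerimeter {n : ℕ} (F : EuclideanSpace ℝ (Fin n) → ℝ)
    (Ω : Set (EuclideanSpace ℝ (Fin n))) : ℝ :=
  ∫ x in frontier Ω, F (outwardNormal Ω x) ∂(μHE[n - 1])

/-- The anisotropic `p`-boundary momentum `M_F(Ω) = ∫_{∂Ω} F°(x)ᵖ F(ν) dℋⁿ⁻¹`. -/
def boundaryMomentum {n : ℕ} (p : ℝ) (F : EuclideanSpace ℝ (Fin n) → ℝ)
    (Ω : Set (EuclideanSpace ℝ (Fin n))) : ℝ :=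
  ∫ x in frontier Ω, polar F x ^ p * F (outwardNormal Ω x) ∂(μHE[n - 1])

/-- The scale invariant functional `𝓕(Ω) = M_F(Ω) / (P_F(Ω) V(Ω)^{p/n})`. -/
def functional {n : ℕ} (p : ℝ) (F : EuclideanSpace ℝ (Fin n) → ℝ)
    (Ω : Set (EuclideanSpace ℝ (Fin n))) : ℝ :=
  boundaryMomentum p F Ω / (anisotropicPerimeter F Ω * vol Ω ^ (p / (n : ℝ)))

/-- `r_max(Ω)`, the maximum of `F°` over the closure of `Ω`. -/
def rMax {n : ℕ} (F : EuclideanSpace ℝ (Fin n) → ℝ) (Ω : Set (EuclideanSpace ℝ (Fin n))) : ℝ :=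
  sSup (polar F '' closure Ω)

/-- The anisotropic `p`-excess `E_F(Ω) = r_max(Ω)^{p-1} - M_F(Ω) / (n V(Ω))`. -/
def excess {n : ℕ} (p : ℝ) (F : EuclideanSpace ℝ (Fin n) → ℝ)
    (Ω : Set (EuclideanSpace ℝ (Fin n))) : ℝ :=
  rMax F Ω ^ (p - 1) - boundaryMomentum p F Ω / ((n : ℝ) * vol Ω)

/-- Nonempty bounded open convex sets. -/
structure IsConvexDomain {n : ℕ} (Ω : Set (EuclideanSpace ℝ (Fin n))) : Prop where
  nonempty : Ω.Nonempty
  isBounded : Bornology.IsBounded Ω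
  isOpen : IsOpen Ω
  convex : Convex ℝ Ω

/-- `Ω` minimizes `𝓕` among all nonempty bounded open convex sets. -/
def IsMinimizer {n : ℕ} (p : ℝ) (F : EuclideanSpace ℝ (Fin n) → ℝ)
    (Ω : Set (EuclideanSpace ℝ (Fin n))) : Prop :=
  IsConvexDomain Ω ∧
    ∀ Ω' : Set (EuclideanSpace ℝ (Fin n)), IsConvexDomain Ω' → functional p F Ω ≤ functional p F Ω'

end AnisotropicMomentum

end

/-!
Write `R = rMax F Ω`, `V`, `P`, `M` for the maximal radius, the volume, the anisotropic perimeter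
and the boundary momentum of `Ω`, and `c = M / P` for the mean of `F° ^ p` over the boundary. The
set `Ω` is contained in the Wulff shape of radius `R`, and unless it equals that Wulff shape, some
boundary point has `F° < R`; then `c < R ^ p` (`IsFinslerNorm.boundaryMomentum_lt`). Minimality is
refuted by comparing `Ω` with the convex set `K` obtained by cutting it with the Wulff shape of a
radius `s` slightly below `R`.

Let `D` be the part cut off. Near `F° = R` the weight `g(t) = t ^ p - c` is positive, and the
divergence of the radial field `g(F°) x / F°` is at least `κ = (n + p - 1) s ^ (p - 1) - c (n - 1)
/ s` on `D`. Its flux through the boundary of `Ω` is at most the integral of `g(F°) F(ν)`, because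
`⟪ν, x⟫ ≤ F(ν) F°(x)`, with equality on a Wulff shape. Hence the cut lowers the perimeter weighted
by `g(F°)` by at least `κ |D|` (`IsFinslerNorm.weightedPerimeter_inter_wulffShape_le`), that is,
`M(K) - c P(K) ≤ -κ |D|`. It does not increase the perimeter. With the minimality of `Ω` this
gives `κ |K| ≤ (p / n) M` (`IsMinimizer.mul_vol_le`). As `s` tends to `R`, and with `M = n V R ^
(p - 1)`, which is the condition on the excess, the limit reads `(n - 1) R ^ p ≤ (n - 1) c`, which
contradicts `c < R ^ p`.

The boundaries are only those of convex sets, so the flux inequality (`IsFinslerNorm.flux_le`) is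
proved by measuring cones with vertex `0`. The part in a set `Z` of the cone over a piece `A` of
the boundary has at most the volume `∫_A |⟪ν, a⟫| w_Z(a)`, where `w_Z` weighs the part of the ray
to `a` in `Z` (`IsConvexDomain.volume_openCone_inter_le`). For boundaries of Wulff shapes, which a
ray meets once, the inequality also holds in the other direction
(`IsConvexDomain.lintegral_outwardNormal_le`). Every ray through a point of `Ω` outside the Wulff
shape leaves `Ω` at a boundary point at a level above `s`, so both the cut-off part and the cone
over the new boundary are covered by the cone over the old boundary, and the divergence bound
becomes a one-dimensional inequality along each ray.

The two cone inequalities come from the change of variables formula on patches of the boundary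
that are graphs over a hyperplane. Here a patch lies in the zero set of a Lipschitz function on the
whole space (`height`), which increases with unit speed along the direction `e` of the graph and
is, by Rademacher's theorem, differentiable at almost every point of its zero set. At a boundary
point with a unique normal the direction `e` can be chosen so that the graph is as flat as desired
(`exists_isGraphDirection_of_existsUnique`). Surface measure and the projected Lebesgue measure
then differ by a factor as close to `1` as desired, so no area formula for Hausdorff measure is
needed: the Lipschitz bounds in both directions suffice.
-/

namespace AnisotropicMomentum

/-! ### Normals of convex domains and graph directions -/

section Normals

variable {n : ℕ} {Ω : Set (EuclideanSpace ℝ (Fin n))}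

theorem IsOutwardUnitNormal.inner_le {x ν y : EuclideanSpace ℝ (Fin n)}
    (h : IsOutwardUnitNormal Ω x ν) (hy : y ∈ closure Ω) : ⟪ν, y - x⟫ ≤ 0 := by
  have hc : IsClosed {y : EuclideanSpace ℝ (Fin n) | ⟪ν, y - x⟫ ≤ 0} :=
    isClosed_le (by fun_prop) continuous_const
  exact closure_minimal (fun y hy => h.2 y hy) hc hy

theorem IsOutwardUnitNormal.mono {Ω' : Set (EuclideanSpace ℝ (Fin n))}
    {x ν : EuclideanSpace ℝ (Fin n)} (h : IsOutwardUnitNormal Ω x ν) (hs : Ω' ⊆ Ω) :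
    IsOutwardUnitNormal Ω' x ν :=
  ⟨h.1, fun y hy => h.2 y (hs hy)⟩

theorem isClosed_setOf_isOutwardUnitNormal :
    IsClosed {q : EuclideanSpace ℝ (Fin n) × EuclideanSpace ℝ (Fin n) |
      IsOutwardUnitNormal Ω q.1 q.2} := by
  have : {q : EuclideanSpace ℝ (Fin n) × EuclideanSpace ℝ (Fin n) |
      IsOutwardUnitNormal Ω q.1 q.2} =
      {q | ‖q.2‖ = 1} ∩ ⋂ y ∈ Ω, {q | ⟪q.2, y - q.1⟫ ≤ 0} := by
    ext q; simp [IsOutwardUnitNormal]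
  rw [this]
  refine (isClosed_eq (by fun_prop) continuous_const).inter ?_
  exact isClosed_biInter fun y _ => isClosed_le (by fun_prop) continuous_const

theorem IsConvexDomain.exists_normal (hΩ : IsConvexDomain Ω) {x : EuclideanSpace ℝ (Fin n)}
    (hx : x ∈ frontier Ω) : ∃ ν, IsOutwardUnitNormal Ω x ν := by
  have hx' : x ∉ Ω := by
    rw [hΩ.isOpen.frontier_eq] at hx; exact hx.2
  obtain ⟨f, hf⟩ := geometric_hahn_banach_open_point hΩ.convex hΩ.isOpen hx'
  set v := (InnerProductSpace.toDual ℝ (EuclideanSpace ℝ (Fin n))).symm f with hv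
  have hfv : ∀ y, f y = ⟪v, y⟫ := fun y => by simp [hv]
  have hv0 : v ≠ 0 := by
    intro h0
    obtain ⟨y, hy⟩ := hΩ.nonempty
    have := hf y hy
    simp [hfv, h0] at this
  refine ⟨‖v‖⁻¹ • v, norm_smul_inv_norm hv0, fun y hy => ?_⟩
  rw [inner_smul_left, inner_sub_right, ← hfv, ← hfv]
  have := hf y hy
  simp only [map_inv₀, conj_trivial]
  exact mul_nonpos_of_nonneg_of_nonpos (by positivity) (by linarith)

theorem outwardNormal_eq {x ν : EuclideanSpace ℝ (Fin n)}
    (h : ∃! ν, IsOutwardUnitNormal Ω x ν) (hν : IsOutwardUnitNormal Ω x ν) :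
    outwardNormal Ω x = ν := by
  rw [outwardNormal, dif_pos h]
  exact h.unique h.choose_spec.1 hν

theorem outwardNormal_of_not {x : EuclideanSpace ℝ (Fin n)}
    (h : ¬ ∃! ν, IsOutwardUnitNormal Ω x ν) : outwardNormal Ω x = 0 := by
  rw [outwardNormal, dif_neg h]

theorem norm_outwardNormal_le (x : EuclideanSpace ℝ (Fin n)) : ‖outwardNormal Ω x‖ ≤ 1 := by
  by_cases h : ∃! ν, IsOutwardUnitNormal Ω x ν
  · obtain ⟨ν, hν⟩ := h.exists
    rw [outwardNormal_eq h hν, hν.1]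
  · simp [outwardNormal_of_not h]

/-- The part of the boundary of `Ω` lying in `U` is a Lipschitz graph over the hyperplane
orthogonal to the unit vector `e`: every outward normal there makes an angle with `e` whose cosine
is at least `c > 0`. -/
structure IsGraphDirection (Ω U : Set (EuclideanSpace ℝ (Fin n))) (e : EuclideanSpace ℝ (Fin n))
    (c : ℝ) : Prop where
  norm_eq : ‖e‖ = 1
  pos : 0 < c
  nonempty : (U ∩ frontier Ω).Nonempty
  le_inner : ∀ x ∈ U ∩ frontier Ω, ∀ ν, IsOutwardUnitNormal Ω x ν → c ≤ ⟪ν, e⟫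

/-- Near any boundary point the boundary is a graph in the direction pointing away from an interior
point. -/
theorem IsConvexDomain.exists_isGraphDirection (hΩ : IsConvexDomain Ω)
    {x₀ : EuclideanSpace ℝ (Fin n)} (hx₀ : x₀ ∈ frontier Ω) :
    ∃ U e c, IsOpen U ∧ x₀ ∈ U ∧ IsGraphDirection Ω U e c := by
  obtain ⟨z, hz⟩ := hΩ.nonempty
  obtain ⟨ρ, hρ, hball⟩ := Metric.isOpen_iff.1 hΩ.isOpen z hz
  have hx₀' : x₀ ∉ Ω := by
    rw [hΩ.isOpen.frontier_eq] at hx₀; exact hx₀.2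
  have hne : x₀ - z ≠ 0 := fun h => hx₀' (by rwa [sub_eq_zero.1 h])
  have hpos : 0 < ‖x₀ - z‖ := norm_pos_iff.2 hne
  refine ⟨Metric.ball x₀ (ρ / 4), ‖x₀ - z‖⁻¹ • (x₀ - z), ‖x₀ - z‖⁻¹ * (ρ / 4), Metric.isOpen_ball,
    Metric.mem_ball_self (by positivity), norm_smul_inv_norm hne, by positivity,
    ⟨x₀, Metric.mem_ball_self (by positivity), hx₀⟩, ?_⟩
  rintro x ⟨hx, -⟩ ν hν
  rw [inner_smul_right]
  refine mul_le_mul_of_nonneg_left ?_ (by positivity)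
  -- the ball about `z` of radius `ρ` contains `z + (ρ / 2) • ν`
  have h1 : z + (ρ / 2) • ν ∈ Ω := hball (by
    simp [norm_smul, hν.1, abs_of_pos hρ]; linarith)
  have h2 := hν.2 _ h1
  have h3 : ⟪ν, x₀ - x⟫ ≥ -(ρ / 4) := by
    have h4 := abs_real_inner_le_norm ν (x₀ - x)
    rw [hν.1, one_mul] at h4
    have h5 : ‖x₀ - x‖ < ρ / 4 := by rwa [← dist_eq_norm, dist_comm]
    linarith [neg_abs_le ⟪ν, x₀ - x⟫]
  have h6 : ⟪ν, ν⟫ = 1 := by rw [real_inner_self_eq_norm_sq, hν.1]; norm_num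
  have h7 : z + (ρ / 2) • ν - x = (ρ / 2) • ν - (x₀ - z) + (x₀ - x) := by abel
  rw [h7, inner_add_right, inner_sub_right, inner_smul_right, h6] at h2
  linarith

/-- Near a boundary point with a unique normal the boundary is a graph of arbitrarily small slope
in the direction of the normal. -/
theorem exists_isGraphDirection_of_existsUnique
    {x₀ : EuclideanSpace ℝ (Fin n)} (hx₀ : x₀ ∈ frontier Ω)
    (h : ∃! ν, IsOutwardUnitNormal Ω x₀ ν) {c : ℝ} (hc0 : 0 < c) (hc : c < 1) :
    ∃ U e, IsOpen U ∧ x₀ ∈ U ∧ IsGraphDirection Ω U e c := by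
  obtain ⟨ν₀, hν₀⟩ := h.exists
  let T : Set (EuclideanSpace ℝ (Fin n)) := Metric.sphere 0 1 ∩ {ν | ⟪ν, ν₀⟫ ≤ c}
  have hT : IsCompact T :=
    (isCompact_sphere _ _).inter_right (isClosed_le (by fun_prop) continuous_const)
  have : CompactSpace T := isCompact_iff_compactSpace.1 hT
  let K : Set (EuclideanSpace ℝ (Fin n) × T) := {q | IsOutwardUnitNormal Ω q.1 q.2}
  have hK : IsClosed K := by
    have : Continuous fun q : EuclideanSpace ℝ (Fin n) × T =>
        (q.1, (q.2 : EuclideanSpace ℝ (Fin n))) := by fun_prop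
    exact isClosed_setOf_isOutwardUnitNormal.preimage this
  have hK' : IsClosed (Prod.fst '' K) := isClosedMap_fst_of_compactSpace _ hK
  have hxK : x₀ ∉ Prod.fst '' K := by
    rintro ⟨⟨x, ν, hν⟩, hq, rfl⟩
    have : ν = ν₀ := h.unique hq hν₀
    have h1 := hν.2
    simp only [mem_ofPred_eq, this, real_inner_self_eq_norm_sq, hν₀.1] at h1
    linarith
  refine ⟨(Prod.fst '' K)ᶜ, ν₀, hK'.isOpen_compl, hxK, hν₀.1, hc0, ⟨x₀, hxK, hx₀⟩, ?_⟩
  rintro x ⟨hx, -⟩ ν hν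
  by_contra hcon
  push Not at hcon
  exact hx ⟨(x, ⟨ν, by simp [hν.1], hcon.le⟩), hν, rfl⟩

end Normals

/-! ### The height function of a boundary patch -/

section Height

variable {n : ℕ} {Ω U : Set (EuclideanSpace ℝ (Fin n))} {e : EuclideanSpace ℝ (Fin n)} {c : ℝ}

/-- The signed height, in the direction `e`, above the supporting hyperplanes of `Ω` at the boundary
points in `U`: the supremum of the `t` for which `y - t • e` lies on one of them. It is a convex
function on the whole space that vanishes on the patch `U ∩ frontier Ω` and grows with unit speed in
the direction `e`. -/
noncomputable def height (Ω U : Set (EuclideanSpace ℝ (Fin n))) (e y : EuclideanSpace ℝ (Fin n)) :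
    ℝ :=
  ⨆ q : {q : EuclideanSpace ℝ (Fin n) × EuclideanSpace ℝ (Fin n) //
    q.1 ∈ U ∩ frontier Ω ∧ IsOutwardUnitNormal Ω q.1 q.2}, ⟪q.1.2, y - q.1.1⟫ / ⟪q.1.2, e⟫

/-- The projection along `e` to the graph `{height = 0}`, which contains the patch. -/
noncomputable def foot (Ω U : Set (EuclideanSpace ℝ (Fin n))) (e y : EuclideanSpace ℝ (Fin n)) :
    EuclideanSpace ℝ (Fin n) :=
  y - height Ω U e y • e

theorem IsGraphDirection.nonempty_index (hU : IsGraphDirection Ω U e c) (hΩ : IsConvexDomain Ω) :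
    Nonempty {q : EuclideanSpace ℝ (Fin n) × EuclideanSpace ℝ (Fin n) //
      q.1 ∈ U ∩ frontier Ω ∧ IsOutwardUnitNormal Ω q.1 q.2} := by
  obtain ⟨x, hx⟩ := hU.nonempty
  obtain ⟨ν, hν⟩ := hΩ.exists_normal hx.2
  exact ⟨⟨(x, ν), hx, hν⟩⟩

theorem IsGraphDirection.inner_div_le (hU : IsGraphDirection Ω U e c)
    {a ν v : EuclideanSpace ℝ (Fin n)} (ha : a ∈ U ∩ frontier Ω) (hν : IsOutwardUnitNormal Ω a ν) :
    ⟪ν, v⟫ / ⟪ν, e⟫ ≤ c⁻¹ * ‖v‖ := by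
  have h1 := hU.le_inner a ha ν hν
  have h2 := hU.pos
  have h3 : ⟪ν, v⟫ ≤ ‖v‖ := by
    simpa [hν.1] using real_inner_le_norm ν v
  calc ⟪ν, v⟫ / ⟪ν, e⟫ ≤ ‖v‖ / ⟪ν, e⟫ := by
        exact div_le_div_of_nonneg_right h3 (by linarith)
    _ ≤ ‖v‖ / c := div_le_div_of_nonneg_left (norm_nonneg _) h2 h1
    _ = c⁻¹ * ‖v‖ := by rw [div_eq_inv_mul]

theorem IsGraphDirection.bddAbove (hU : IsGraphDirection Ω U e c) (hΩ : IsConvexDomain Ω)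
    (y : EuclideanSpace ℝ (Fin n)) :
    BddAbove (range fun q : {q : EuclideanSpace ℝ (Fin n) × EuclideanSpace ℝ (Fin n) //
      q.1 ∈ U ∩ frontier Ω ∧ IsOutwardUnitNormal Ω q.1 q.2} =>
        ⟪q.1.2, y - q.1.1⟫ / ⟪q.1.2, e⟫) := by
  obtain ⟨R, hR⟩ := hΩ.isBounded.closure.exists_norm_le
  refine ⟨c⁻¹ * (‖y‖ + R), ?_⟩
  rintro _ ⟨⟨⟨a, ν⟩, ha, hν⟩, rfl⟩
  have hc := hU.pos
  have h4 : ‖y - a‖ ≤ ‖y‖ + R :=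
    (norm_sub_le _ _).trans (by linarith [hR a (frontier_subset_closure ha.2)])
  exact (hU.inner_div_le ha hν).trans (mul_le_mul_of_nonneg_left h4 (by positivity))

theorem IsGraphDirection.le_height (hU : IsGraphDirection Ω U e c) (hΩ : IsConvexDomain Ω)
    {a ν : EuclideanSpace ℝ (Fin n)} (ha : a ∈ U ∩ frontier Ω) (hν : IsOutwardUnitNormal Ω a ν)
    (y : EuclideanSpace ℝ (Fin n)) : ⟪ν, y - a⟫ / ⟪ν, e⟫ ≤ height Ω U e y :=
  le_ciSup (hU.bddAbove hΩ y) ⟨(a, ν), ha, hν⟩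

theorem IsGraphDirection.height_le (hU : IsGraphDirection Ω U e c) (hΩ : IsConvexDomain Ω)
    {y : EuclideanSpace ℝ (Fin n)} {M : ℝ} (h : ∀ a ∈ U ∩ frontier Ω,
      ∀ ν, IsOutwardUnitNormal Ω a ν → ⟪ν, y - a⟫ / ⟪ν, e⟫ ≤ M) : height Ω U e y ≤ M := by
  have := hU.nonempty_index hΩ
  exact ciSup_le fun q => h _ q.2.1 _ q.2.2

theorem IsGraphDirection.lipschitzWith_height (hU : IsGraphDirection Ω U e c)
    (hΩ : IsConvexDomain Ω) : LipschitzWith (Real.toNNReal c⁻¹) (height Ω U e) := by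
  refine LipschitzWith.of_le_add_mul _ fun y y' => ?_
  rw [Real.coe_toNNReal _ (inv_nonneg.2 hU.pos.le), dist_eq_norm]
  refine hU.height_le hΩ fun a ha ν hν => ?_
  have h1 := hU.le_height hΩ ha hν y'
  have h2 := hU.inner_div_le ha hν (v := y - y')
  have h3 : ⟪ν, y - a⟫ = ⟪ν, y' - a⟫ + ⟪ν, y - y'⟫ := by
    rw [← inner_add_right]; congr 1; abel
  rw [h3, add_div]; linarith

theorem IsGraphDirection.height_add_smul (hU : IsGraphDirection Ω U e c) (hΩ : IsConvexDomain Ω)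
    (y : EuclideanSpace ℝ (Fin n)) (t : ℝ) :
    height Ω U e (y + t • e) = height Ω U e y + t := by
  have key : ∀ y : EuclideanSpace ℝ (Fin n), ∀ t : ℝ,
      height Ω U e (y + t • e) ≤ height Ω U e y + t := by
    intro y t
    refine hU.height_le hΩ fun a ha ν hν => ?_
    have h1 := hU.le_height hΩ ha hν y
    have h2 := hU.le_inner a ha ν hν
    have h3 : ⟪ν, e⟫ ≠ 0 := by linarith [hU.pos]
    have h4 : y + t • e - a = (y - a) + t • e := by abel
    rw [h4, inner_add_right, inner_smul_right, add_div, mul_div_cancel_right₀ _ h3]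
    linarith
  refine le_antisymm (key y t) ?_
  have := key (y + t • e) (-t)
  rw [neg_smul, add_neg_cancel_right] at this
  linarith

theorem IsGraphDirection.height_eq_zero (hU : IsGraphDirection Ω U e c) (hΩ : IsConvexDomain Ω)
    {a : EuclideanSpace ℝ (Fin n)} (ha : a ∈ U ∩ frontier Ω) : height Ω U e a = 0 := by
  refine le_antisymm (hU.height_le hΩ fun b hb ν hν => ?_) ?_
  · exact div_nonpos_of_nonpos_of_nonneg (hν.inner_le (frontier_subset_closure ha.2))
      (by linarith [hU.le_inner b hb ν hν, hU.pos])
  · obtain ⟨ν, hν⟩ := hΩ.exists_normal ha.2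
    simpa using hU.le_height hΩ ha hν a

theorem IsGraphDirection.foot_add_smul (hU : IsGraphDirection Ω U e c) (hΩ : IsConvexDomain Ω)
    (y : EuclideanSpace ℝ (Fin n)) (t : ℝ) : foot Ω U e (y + t • e) = foot Ω U e y := by
  rw [foot, foot, hU.height_add_smul hΩ, add_smul]; abel

theorem IsGraphDirection.foot_eq_self (hU : IsGraphDirection Ω U e c) (hΩ : IsConvexDomain Ω)
    {a : EuclideanSpace ℝ (Fin n)} (ha : a ∈ U ∩ frontier Ω) : foot Ω U e a = a := by
  rw [foot, hU.height_eq_zero hΩ ha, zero_smul, sub_zero]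

theorem IsGraphDirection.continuous_height (hU : IsGraphDirection Ω U e c)
    (hΩ : IsConvexDomain Ω) : Continuous (height Ω U e) :=
  (hU.lipschitzWith_height hΩ).continuous

theorem IsGraphDirection.continuous_foot (hU : IsGraphDirection Ω U e c)
    (hΩ : IsConvexDomain Ω) : Continuous (foot Ω U e) :=
  continuous_id.sub ((hU.continuous_height hΩ).smul continuous_const)

/-- The derivative of the height at a point of the patch is the normal covector, scaled to take the
value `1` at `e`: the supporting affine function touches the height from below there. -/
theorem IsGraphDirection.fderiv_height (hU : IsGraphDirection Ω U e c) (hΩ : IsConvexDomain Ω)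
    {a ν : EuclideanSpace ℝ (Fin n)} (ha : a ∈ U ∩ frontier Ω) (hν : IsOutwardUnitNormal Ω a ν)
    (hd : DifferentiableAt ℝ (height Ω U e) a) (v : EuclideanSpace ℝ (Fin n)) :
    fderiv ℝ (height Ω U e) a v = ⟪ν, v⟫ / ⟪ν, e⟫ := by
  let ℓ : EuclideanSpace ℝ (Fin n) →L[ℝ] ℝ := (⟪ν, e⟫)⁻¹ • innerSL ℝ ν
  have hℓ : ∀ w, ℓ w = ⟪ν, w⟫ / ⟪ν, e⟫ := fun w => by
    simp [ℓ, div_eq_inv_mul]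
  have hmin : IsLocalMin (fun y => height Ω U e y - ℓ y) a := by
    refine Filter.Eventually.of_forall fun y => ?_
    have h1 := hU.le_height hΩ ha hν y
    simp only [hU.height_eq_zero hΩ ha]
    rw [← hℓ, map_sub] at h1
    linarith
  have h0 := hmin.hasFDerivAt_eq_zero (hd.hasFDerivAt.sub ℓ.hasFDerivAt)
  rw [sub_eq_zero.1 h0, hℓ]

/-- Differentiability of the height propagates along the direction `e`. -/
theorem IsGraphDirection.hasFDerivAt_height_add_smul (hU : IsGraphDirection Ω U e c)
    (hΩ : IsConvexDomain Ω) {y : EuclideanSpace ℝ (Fin n)}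
    (hd : DifferentiableAt ℝ (height Ω U e) y) (t : ℝ) :
    HasFDerivAt (height Ω U e) (fderiv ℝ (height Ω U e) y) (y + t • e) := by
  have h2 : HasFDerivAt (height Ω U e) (fderiv ℝ (height Ω U e) y) (y + t • e - t • e) := by
    rw [add_sub_cancel_right]; exact hd.hasFDerivAt
  have h3 := (h2.comp (y + t • e) ((hasFDerivAt_id (y + t • e)).sub_const (t • e))).add_const t
  rw [ContinuousLinearMap.comp_id] at h3
  refine h3.congr_of_eventuallyEq (Filter.Eventually.of_forall fun x => ?_)
  change height Ω U e x = height Ω U e (x - t • e) + t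
  rw [← hU.height_add_smul hΩ, sub_add_cancel]

theorem IsGraphDirection.existsUnique_normal (hU : IsGraphDirection Ω U e c)
    (hΩ : IsConvexDomain Ω) {a : EuclideanSpace ℝ (Fin n)} (ha : a ∈ U ∩ frontier Ω)
    (hd : DifferentiableAt ℝ (height Ω U e) a) : ∃! ν, IsOutwardUnitNormal Ω a ν := by
  obtain ⟨ν, hν⟩ := hΩ.exists_normal ha.2
  refine ⟨ν, hν, fun ν' hν' => ?_⟩
  have hp := hU.pos.trans_le (hU.le_inner a ha ν hν)
  have hp' := hU.pos.trans_le (hU.le_inner a ha ν' hν')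
  have h1 : (⟪ν', e⟫)⁻¹ • ν' = (⟪ν, e⟫)⁻¹ • ν := by
    refine ext_inner_right ℝ fun v => ?_
    rw [real_inner_smul_left, real_inner_smul_left, ← div_eq_inv_mul, ← div_eq_inv_mul,
      ← hU.fderiv_height hΩ ha hν' hd, ← hU.fderiv_height hΩ ha hν hd]
  have h2 : (⟪ν', e⟫)⁻¹ = (⟪ν, e⟫)⁻¹ := by
    have := congrArg norm h1
    rwa [norm_smul, norm_smul, hν.1, hν'.1, mul_one, mul_one, Real.norm_of_nonneg (by positivity),
      Real.norm_of_nonneg (by positivity)] at this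
  rw [h2] at h1
  exact smul_right_injective _ (inv_ne_zero hp.ne') h1

theorem IsGraphDirection.fderiv_height_eq_outwardNormal (hU : IsGraphDirection Ω U e c)
    (hΩ : IsConvexDomain Ω) {a : EuclideanSpace ℝ (Fin n)} (ha : a ∈ U ∩ frontier Ω)
    (hd : DifferentiableAt ℝ (height Ω U e) a) (v : EuclideanSpace ℝ (Fin n)) :
    fderiv ℝ (height Ω U e) a v = ⟪outwardNormal Ω a, v⟫ / ⟪outwardNormal Ω a, e⟫ := by
  have h := hU.existsUnique_normal hΩ ha hd
  obtain ⟨ν, hν⟩ := h.exists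
  rw [outwardNormal_eq h hν, hU.fderiv_height hΩ ha hν hd]

theorem IsGraphDirection.le_inner_outwardNormal (hU : IsGraphDirection Ω U e c)
    (hΩ : IsConvexDomain Ω) {a : EuclideanSpace ℝ (Fin n)} (ha : a ∈ U ∩ frontier Ω)
    (hd : DifferentiableAt ℝ (height Ω U e) a) : c ≤ ⟪outwardNormal Ω a, e⟫ := by
  have h := hU.existsUnique_normal hΩ ha hd
  obtain ⟨ν, hν⟩ := h.exists
  rw [outwardNormal_eq h hν]
  exact hU.le_inner a ha ν hν

/-- Two points of the patch are at most `c⁻¹` times as far apart as their projections to the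
hyperplane orthogonal to `e`. -/
theorem IsGraphDirection.norm_sub_le (hU : IsGraphDirection Ω U e c)
    (hΩ : IsConvexDomain Ω) {a b : EuclideanSpace ℝ (Fin n)} (ha : a ∈ U ∩ frontier Ω)
    (hb : b ∈ U ∩ frontier Ω) : ‖a - b‖ ≤ c⁻¹ * ‖(a - b) - ⟪a - b, e⟫ • e‖ := by
  have he : ⟪e, e⟫ = 1 := by rw [real_inner_self_eq_norm_sq, hU.norm_eq]; norm_num
  -- the one-sided bound on the vertical part, from a normal at the lower point
  have key : ∀ a ∈ U ∩ frontier Ω, ∀ b ∈ U ∩ frontier Ω, 0 ≤ ⟪a - b, e⟫ →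
      ‖a - b‖ ≤ c⁻¹ * ‖(a - b) - ⟪a - b, e⟫ • e‖ := by
    intro a ha b hb h0
    obtain ⟨ν, hν⟩ := hΩ.exists_normal hb.2
    set s := ⟪a - b, e⟫ with hs
    set w := (a - b) - s • e with hw
    have hab : a - b = w + s • e := by rw [hw]; abel
    have hwe : ⟪w, e⟫ = 0 := by
      rw [hw, inner_sub_left, real_inner_smul_left, he, ← hs]; ring
    set r := ⟪ν, e⟫ with hr
    have hcr : c ≤ r := hU.le_inner b hb ν hν
    have hc := hU.pos
    have h1 : ⟪ν, w⟫ + s * r ≤ 0 := by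
      have := hν.inner_le (frontier_subset_closure ha.2)
      rwa [hab, inner_add_right, inner_smul_right] at this
    have hν2 : ⟪ν, ν⟫ = 1 := by rw [real_inner_self_eq_norm_sq, hν.1]; norm_num
    have h2 : ‖ν - r • e‖ ^ 2 = 1 - r ^ 2 := by
      rw [← real_inner_self_eq_norm_sq, inner_sub_left, inner_sub_right, inner_sub_right,
        real_inner_smul_left, real_inner_smul_left, inner_smul_right, inner_smul_right,
        real_inner_comm ν e, ← hr, he, hν2]
      ring
    have h3 : ⟪ν, w⟫ = ⟪ν - r • e, w⟫ := by
      rw [inner_sub_left, real_inner_smul_left, real_inner_comm w e, hwe]; ring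
    have h4 : s * r ≤ ‖ν - r • e‖ * ‖w‖ := by
      have := abs_real_inner_le_norm (ν - r • e) w
      rw [← h3] at this
      linarith [neg_abs_le ⟪ν, w⟫]
    have h5 : (s * r) ^ 2 ≤ (1 - r ^ 2) * ‖w‖ ^ 2 := by
      have : 0 ≤ s * r := mul_nonneg h0 (by linarith)
      calc (s * r) ^ 2 ≤ (‖ν - r • e‖ * ‖w‖) ^ 2 := pow_le_pow_left₀ this h4 2
        _ = _ := by rw [mul_pow, h2]
    have h6 : ‖a - b‖ ^ 2 = ‖w‖ ^ 2 + s ^ 2 := by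
      rw [hab, norm_add_sq_real, inner_smul_right, hwe, norm_smul, hU.norm_eq,
        Real.norm_eq_abs, mul_one, sq_abs]
      ring
    have h7 : (c * ‖a - b‖) ^ 2 ≤ ‖w‖ ^ 2 := by
      have h8 : c ^ 2 * ‖a - b‖ ^ 2 ≤ r ^ 2 * ‖a - b‖ ^ 2 := by gcongr
      rw [mul_pow]
      nlinarith
    have h9 : c * ‖a - b‖ ≤ ‖w‖ := le_of_sq_le_sq h7 (norm_nonneg _)
    rw [← div_eq_inv_mul, le_div_iff₀ hc]; linarith
  rcases le_total 0 ⟪a - b, e⟫ with h | h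
  · exact key a ha b hb h
  · have := key b hb a ha (by rw [← neg_sub a b, inner_neg_left]; linarith)
    rw [← neg_sub a b, inner_neg_left, neg_smul, sub_neg_eq_add, norm_neg] at this
    rwa [show -(a - b) + ⟪a - b, e⟫ • e = -((a - b) - ⟪a - b, e⟫ • e) by abel, norm_neg] at this

end Height

/-! ### Surface measure of a boundary patch -/

section Surface

variable {n : ℕ} {Ω U : Set (EuclideanSpace ℝ (Fin n))} {e : EuclideanSpace ℝ (Fin n)} {c : ℝ}

theorem _root_.LipschitzOnWith.euclideanHausdorffMeasure_image_le {X Y : Type*} [EMetricSpace X]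
    [MeasurableSpace X] [BorelSpace X] [EMetricSpace Y] [MeasurableSpace Y] [BorelSpace Y]
    {K : NNReal} {f : X → Y} {s : Set X} (h : LipschitzOnWith K f s) (d : ℕ) :
    μHE[d] (f '' s) ≤ (K : ENNReal) ^ d * μHE[d] s := by
  simp only [Measure.euclideanHausdorffMeasure_def, Measure.smul_apply, ENNReal.smul_def,
    smul_eq_mul]
  have := h.hausdorffMeasure_image_le (d := d) (Nat.cast_nonneg d)
  rw [ENNReal.rpow_natCast] at this
  calc _ ≤ _ := mul_le_mul_right this _
    _ = _ := by ring

theorem finrank_orthogonal_span_singleton_eq (he : ‖e‖ = 1) :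
    Module.finrank ℝ (ℝ ∙ e)ᗮ = n - 1 := by
  have h := (ℝ ∙ e).finrank_add_finrank_orthogonal
  have he0 : e ≠ 0 := by rintro rfl; simp at he
  rw [finrank_span_singleton he0, finrank_euclideanSpace_fin] at h
  omega

/-- Fubini's theorem along the unit vector `e`. -/
theorem measurePreserving_orthogonal_add_smul (he : ‖e‖ = 1) :
    MeasurePreserving (fun q : ℝ × (ℝ ∙ e)ᗮ => (q.2 : EuclideanSpace ℝ (Fin n)) + q.1 • e)
      ((volume : Measure ℝ).prod volume) volume := by
  have h1 := ((ℝ ∙ e).measurePreserving_measurableEquivProd (0 : EuclideanSpace ℝ (Fin n))).symm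
  have h2 := (LinearIsometryEquiv.toSpanUnitSingleton e he).measurePreserving
  have h3 := h1.comp (h2.prod (MeasurePreserving.id (volume : Measure (ℝ ∙ e)ᗮ)))
  rw [InnerProductSpace.euclideanHausdorffMeasure_eq_volume] at h3
  convert! h3 using 1
  ext1 q
  simp [Submodule.measurableEquivProd_symm_apply, add_comm]

/-- Lebesgue measure of the hyperplane orthogonal to `e`, carried to the graph `{height = 0}`. -/
noncomputable def graphMeasure (Ω U : Set (EuclideanSpace ℝ (Fin n)))
    (e : EuclideanSpace ℝ (Fin n)) : Measure (EuclideanSpace ℝ (Fin n)) :=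
  (volume : Measure (ℝ ∙ e)ᗮ).map fun y : (ℝ ∙ e)ᗮ => foot Ω U e y

theorem IsGraphDirection.measurable_foot_coe (hU : IsGraphDirection Ω U e c)
    (hΩ : IsConvexDomain Ω) : Measurable fun y : (ℝ ∙ e)ᗮ => foot Ω U e y :=
  ((hU.continuous_foot hΩ).comp continuous_subtype_val).measurable

theorem inner_orthogonal_eq_zero (y : (ℝ ∙ e)ᗮ) : ⟪(y : EuclideanSpace ℝ (Fin n)), e⟫ = 0 :=
  Submodule.mem_orthogonal_singleton_iff_inner_left.1 y.2

theorem orthogonalProjectionOnto_coe_eq (he : ‖e‖ = 1) (x : EuclideanSpace ℝ (Fin n)) :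
    ((ℝ ∙ e)ᗮ.orthogonalProjectionOnto x : EuclideanSpace ℝ (Fin n)) = x - ⟪x, e⟫ • e := by
  rw [Submodule.coe_orthogonalProjectionOnto_apply, Submodule.starProjection_orthogonal_val,
    Submodule.starProjection_unit_singleton ℝ he, real_inner_comm]

/-- Orthogonal projection does not increase surface measure. -/
theorem IsGraphDirection.graphMeasure_le (hU : IsGraphDirection Ω U e c)
    (hΩ : IsConvexDomain Ω) {A : Set (EuclideanSpace ℝ (Fin n))} (hA : MeasurableSet A) :
    graphMeasure Ω U e A ≤ μHE[n - 1] A := by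
  rw [graphMeasure, Measure.map_apply (hU.measurable_foot_coe hΩ) hA,
    ← InnerProductSpace.euclideanHausdorffMeasure_eq_volume,
    finrank_orthogonal_span_singleton_eq hU.norm_eq]
  have hsub : (fun y : (ℝ ∙ e)ᗮ => foot Ω U e y) ⁻¹' A ⊆
      (ℝ ∙ e)ᗮ.orthogonalProjectionOnto '' A := by
    intro y hy
    refine ⟨foot Ω U e y, hy, Subtype.ext ?_⟩
    rw [orthogonalProjectionOnto_coe_eq hU.norm_eq, foot, inner_sub_left,
      inner_orthogonal_eq_zero, real_inner_smul_left, real_inner_self_eq_norm_sq, hU.norm_eq]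
    simp
  have hl := ((ℝ ∙ e)ᗮ.lipschitzWith_orthogonalProjectionOnto.lipschitzOnWith
    (s := A)).euclideanHausdorffMeasure_image_le (n - 1)
  simp only [ENNReal.coe_one, one_pow, one_mul] at hl
  exact (measure_mono hsub).trans hl

/-- The surface measure of a part of the patch exceeds the measure of its projection at most by the
factor `c⁻¹ ^ (n - 1)`. -/
theorem IsGraphDirection.euclideanHausdorffMeasure_le (hU : IsGraphDirection Ω U e c)
    (hΩ : IsConvexDomain Ω) {A : Set (EuclideanSpace ℝ (Fin n))} (hA : MeasurableSet A)
    (hAU : A ⊆ U ∩ frontier Ω) :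
    μHE[n - 1] A ≤ ENNReal.ofReal c⁻¹ ^ (n - 1) * graphMeasure Ω U e A := by
  rw [graphMeasure, Measure.map_apply (hU.measurable_foot_coe hΩ) hA,
    ← InnerProductSpace.euclideanHausdorffMeasure_eq_volume,
    finrank_orthogonal_span_singleton_eq hU.norm_eq]
  set B := (fun y : (ℝ ∙ e)ᗮ => foot Ω U e y) ⁻¹' A with hB
  have hl : LipschitzOnWith (Real.toNNReal c⁻¹) (fun y : (ℝ ∙ e)ᗮ => foot Ω U e y) B := by
    refine LipschitzOnWith.of_dist_le_mul fun y hy y' hy' => ?_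
    rw [Real.coe_toNNReal _ (inv_nonneg.2 hU.pos.le), dist_eq_norm, dist_eq_norm]
    refine (hU.norm_sub_le hΩ (hAU hy) (hAU hy')).trans_eq ?_
    congr 2
    have h1 : foot Ω U e y - foot Ω U e y' = (y - y' : EuclideanSpace ℝ (Fin n)) +
        (height Ω U e y' - height Ω U e y) • e := by
      rw [foot, foot, sub_smul]; abel
    rw [h1, inner_add_left, inner_sub_left, inner_orthogonal_eq_zero, inner_orthogonal_eq_zero,
      real_inner_smul_left, real_inner_self_eq_norm_sq, hU.norm_eq]
    simp
  have hsub : A ⊆ (fun y : (ℝ ∙ e)ᗮ => foot Ω U e y) '' B := by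
    intro a ha
    have h1 : foot Ω U e ((ℝ ∙ e)ᗮ.orthogonalProjectionOnto a) = a := by
      rw [orthogonalProjectionOnto_coe_eq hU.norm_eq, sub_eq_add_neg, ← neg_smul,
        hU.foot_add_smul hΩ, hU.foot_eq_self hΩ (hAU ha)]
    exact ⟨_, by rw [hB, mem_preimage, h1]; exact ha, h1⟩
  exact (measure_mono hsub).trans (hl.euclideanHausdorffMeasure_image_le (n - 1))

/-- By Rademacher's theorem, the height is differentiable at almost every point of its graph. -/
theorem IsGraphDirection.graphMeasure_not_differentiableAt (hU : IsGraphDirection Ω U e c)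
    (hΩ : IsConvexDomain Ω) :
    graphMeasure Ω U e {a | ¬ DifferentiableAt ℝ (height Ω U e) a} = 0 := by
  have hdm : MeasurableSet {a | ¬ DifferentiableAt ℝ (height Ω U e) a} :=
    (measurableSet_of_differentiableAt ℝ (height Ω U e)).compl
  have hae : ∀ᵐ x : EuclideanSpace ℝ (Fin n), DifferentiableAt ℝ (height Ω U e) x :=
    (hU.lipschitzWith_height hΩ).ae_differentiableAt
  have hae2 := (measurePreserving_orthogonal_add_smul hU.norm_eq).quasiMeasurePreserving.ae hae
  have hae3 := Measure.ae_ae_of_ae_prod hae2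
  obtain ⟨t, ht⟩ := hae3.exists
  rw [graphMeasure, Measure.map_apply (hU.measurable_foot_coe hΩ) hdm]
  refine measure_mono_null (fun y hy => ?_) ht
  intro hcon
  apply hy
  have h2 := (hU.hasFDerivAt_height_add_smul hΩ hcon (-t - height Ω U e y)).differentiableAt
  have h3 : (y : EuclideanSpace ℝ (Fin n)) + t • e + (-t - height Ω U e y) • e =
      foot Ω U e y := by
    rw [foot, sub_smul, neg_smul]; abel
  rwa [h3] at h2

end Surface

/-! ### Volume of cones over a boundary patch -/

section Cone

variable {n : ℕ} {Ω U : Set (EuclideanSpace ℝ (Fin n))} {e : EuclideanSpace ℝ (Fin n)} {c : ℝ}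

/-- The open cone with vertex `0` over `A`, without the base `A`. -/
def openCone (A : Set (EuclideanSpace ℝ (Fin n))) : Set (EuclideanSpace ℝ (Fin n)) :=
  {x | ∃ a ∈ A, ∃ t ∈ Ioo (0 : ℝ) 1, x = t • a}

/-- The share of the ray from `0` to `a` that lies in `Z`, weighted by the density `t ^ (n - 1)` of
Lebesgue measure in polar coordinates. -/
noncomputable def coneWeight (Z : Set (EuclideanSpace ℝ (Fin n))) (a : EuclideanSpace ℝ (Fin n)) :
    ENNReal :=
  ∫⁻ t in {t : ℝ | t ∈ Ioo (0 : ℝ) 1 ∧ t • a ∈ Z}, ENNReal.ofReal (t ^ (n - 1))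

/-- Fubini's theorem in the coordinates given by the height and the foot point. -/
theorem IsGraphDirection.lintegral_foot_height (hU : IsGraphDirection Ω U e c)
    (hΩ : IsConvexDomain Ω) {Ψ : EuclideanSpace ℝ (Fin n) × ℝ → ENNReal} (hΨ : Measurable Ψ) :
    ∫⁻ x, Ψ (foot Ω U e x, 1 + height Ω U e x) =
      ∫⁻ a, (∫⁻ t : ℝ, Ψ (a, t)) ∂graphMeasure Ω U e := by
  have hm : Measurable fun x => Ψ (foot Ω U e x, 1 + height Ω U e x) :=
    hΨ.comp ((hU.continuous_foot hΩ).prodMk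
      (continuous_const.add (hU.continuous_height hΩ))).measurable
  have hp := measurePreserving_orthogonal_add_smul hU.norm_eq
  rw [← hp.lintegral_comp hm]
  refine (lintegral_prod_symm' _ (hm.comp hp.measurable)).trans ?_
  rw [graphMeasure, lintegral_map hΨ.lintegral_prod_right' (hU.measurable_foot_coe hΩ)]
  refine lintegral_congr fun y => ?_
  simp only [Function.comp_apply, hU.foot_add_smul hΩ, hU.height_add_smul hΩ, ← add_assoc]
  exact lintegral_add_left_eq_self (fun t => Ψ (foot Ω U e y, t)) (1 + height Ω U e y)

/-- The map `x ↦ (1 + height x) • foot x`, which straightens the cylinder of height one below the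
patch into the cone over it, has Jacobian determinant `(1 + height x) ^ (n - 1)` times the
derivative of the height in the direction of the foot point. -/
theorem IsGraphDirection.exists_hasFDerivAt_coneMap (hU : IsGraphDirection Ω U e c)
    (hΩ : IsConvexDomain Ω) (hn : 1 ≤ n) {x : EuclideanSpace ℝ (Fin n)}
    (hx : foot Ω U e x ∈ U ∩ frontier Ω)
    (hd : DifferentiableAt ℝ (height Ω U e) (foot Ω U e x)) (hr : 1 + height Ω U e x ≠ 0) :
    ∃ D : EuclideanSpace ℝ (Fin n) →L[ℝ] EuclideanSpace ℝ (Fin n),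
      HasFDerivAt (fun y => (1 + height Ω U e y) • foot Ω U e y) D x ∧
      D.det = (1 + height Ω U e x) ^ (n - 1) *
        fderiv ℝ (height Ω U e) (foot Ω U e x) (foot Ω U e x) := by
  set a := foot Ω U e x with ha
  set s := height Ω U e x with hs
  set ℓ := fderiv ℝ (height Ω U e) a with hℓ
  have hxa : a + s • e = x := by rw [ha, foot, ← hs]; abel
  have h1 : HasFDerivAt (height Ω U e) ℓ x := by
    have := hU.hasFDerivAt_height_add_smul hΩ hd s
    rwa [hxa] at this
  have hℓe : ℓ e = 1 := by
    obtain ⟨ν, hν⟩ := hΩ.exists_normal hx.2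
    rw [hℓ, hU.fderiv_height hΩ hx hν hd, div_self]
    linarith [hU.le_inner a hx ν hν, hU.pos]
  have h2 : HasFDerivAt (foot Ω U e)
      (ContinuousLinearMap.id ℝ _ - ℓ.smulRight e) x :=
    (hasFDerivAt_id x).sub (h1.smul_const e)
  refine ⟨_, (h1.const_add 1).smul h2, ?_⟩
  have h3 : (1 + s) • (ContinuousLinearMap.id ℝ (EuclideanSpace ℝ (Fin n)) - ℓ.smulRight e) +
      ℓ.smulRight a = (1 + s) •
      (ContinuousLinearMap.id ℝ (EuclideanSpace ℝ (Fin n)) +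
        ℓ.smulRight ((1 + s)⁻¹ • a - e)) := by
    ext1 v
    simp only [add_apply, smul_apply, sub_apply, ContinuousLinearMap.smulRight_apply,
      ContinuousLinearMap.id_apply, smul_sub, smul_add, smul_smul]
    rw [show (1 + s) * (ℓ v * (1 + s)⁻¹) = ℓ v by field_simp]
    abel
  rw [← ha, ← hs, h3]
  have h4 : ((ContinuousLinearMap.id ℝ (EuclideanSpace ℝ (Fin n)) +
      ℓ.smulRight ((1 + s)⁻¹ • a - e) : EuclideanSpace ℝ (Fin n) →L[ℝ] _) :
      EuclideanSpace ℝ (Fin n) →ₗ[ℝ] EuclideanSpace ℝ (Fin n)) =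
      LinearMap.transvection (ℓ : EuclideanSpace ℝ (Fin n) →ₗ[ℝ] ℝ) ((1 + s)⁻¹ • a - e) := by
    ext1 v
    simp [LinearMap.transvection.apply]
  rw [ContinuousLinearMap.det, ContinuousLinearMap.toLinearMap_smul, LinearMap.det_smul, h4,
    LinearMap.transvection.det, finrank_euclideanSpace_fin]
  simp only [ContinuousLinearMap.coe_coe, map_sub, map_smul, smul_eq_mul, hℓe]
  obtain ⟨m, rfl⟩ : ∃ m, n = m + 1 := ⟨n - 1, by omega⟩
  rw [Nat.add_sub_cancel]
  field_simp
  ring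

/-- The part of the cylinder below `A` that the cone map carries into `Z`. -/
def coneDomain (Ω U : Set (EuclideanSpace ℝ (Fin n))) (e : EuclideanSpace ℝ (Fin n))
    (A Z : Set (EuclideanSpace ℝ (Fin n))) : Set (EuclideanSpace ℝ (Fin n)) :=
  {x | foot Ω U e x ∈ A ∧ 1 + height Ω U e x ∈ Ioo (0 : ℝ) 1 ∧
    (1 + height Ω U e x) • foot Ω U e x ∈ Z}

theorem IsGraphDirection.measurableSet_coneDomain (hU : IsGraphDirection Ω U e c)
    (hΩ : IsConvexDomain Ω) {A Z : Set (EuclideanSpace ℝ (Fin n))} (hA : MeasurableSet A)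
    (hZ : MeasurableSet Z) : MeasurableSet (coneDomain Ω U e A Z) := by
  have h1 := (hU.continuous_foot hΩ).measurable
  have h2 : Measurable fun x => 1 + height Ω U e x :=
    (continuous_const.add (hU.continuous_height hΩ)).measurable
  exact (h1 hA).inter ((h2 measurableSet_Ioo).inter ((h2.smul h1) hZ))

theorem IsGraphDirection.lintegral_coneDomain (hU : IsGraphDirection Ω U e c)
    (hΩ : IsConvexDomain Ω) {A Z : Set (EuclideanSpace ℝ (Fin n))} (hA : MeasurableSet A)
    (hZ : MeasurableSet Z) :
    ∫⁻ x in coneDomain Ω U e A Z, ENNReal.ofReal |(1 + height Ω U e x) ^ (n - 1) *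
        fderiv ℝ (height Ω U e) (foot Ω U e x) (foot Ω U e x)| =
      ∫⁻ a in A, ENNReal.ofReal |fderiv ℝ (height Ω U e) a a| * coneWeight Z a
        ∂graphMeasure Ω U e := by
  let S : Set (EuclideanSpace ℝ (Fin n) × ℝ) :=
    {q | q.1 ∈ A ∧ q.2 ∈ Ioo (0 : ℝ) 1 ∧ q.2 • q.1 ∈ Z}
  have hS : MeasurableSet S := (measurable_fst hA).inter
    ((measurable_snd measurableSet_Ioo).inter ((measurable_snd.smul measurable_fst) hZ))
  have hf : Measurable fun a => fderiv ℝ (height Ω U e) a a := by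
    have h1 : Measurable fun a => (fderiv ℝ (height Ω U e) a, a) :=
      (measurable_fderiv ℝ _).prodMk measurable_id
    exact (isBoundedBilinearMap_apply (𝕜 := ℝ) (E := EuclideanSpace ℝ (Fin n))
      (F := ℝ)).continuous.measurable.comp h1
  let g : EuclideanSpace ℝ (Fin n) × ℝ → ENNReal := fun q =>
    ENNReal.ofReal |q.2 ^ (n - 1) * fderiv ℝ (height Ω U e) q.1 q.1|
  have hg : Measurable g :=
    (((measurable_snd.pow_const _).mul (hf.comp measurable_fst)).abs).ennreal_ofReal
  have h1 := hU.lintegral_foot_height hΩ (hg.indicator hS)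
  have h2 : ∀ x, S.indicator g (foot Ω U e x, 1 + height Ω U e x) =
      (coneDomain Ω U e A Z).indicator (fun x => g (foot Ω U e x, 1 + height Ω U e x)) x :=
    fun x => rfl
  simp only [h2] at h1
  rw [lintegral_indicator (hU.measurableSet_coneDomain hΩ hA hZ)] at h1
  rw [h1, ← lintegral_indicator hA]
  refine lintegral_congr fun a => ?_
  by_cases ha : a ∈ A
  · rw [indicator_of_mem ha, coneWeight]
    have hT : MeasurableSet {t : ℝ | t ∈ Ioo (0 : ℝ) 1 ∧ t • a ∈ Z} :=
      measurableSet_Ioo.inter ((measurable_id.smul_const a) hZ)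
    rw [← lintegral_const_mul _ (by fun_prop), ← lintegral_indicator hT]
    refine lintegral_congr fun t => ?_
    by_cases ht : t ∈ {t : ℝ | t ∈ Ioo (0 : ℝ) 1 ∧ t • a ∈ Z}
    · rw [indicator_of_mem ht, indicator_of_mem (show (a, t) ∈ S from ⟨ha, ht⟩)]
      have : 0 ≤ t ^ (n - 1) := pow_nonneg ht.1.1.le _
      simp only [g]
      rw [← ENNReal.ofReal_mul (abs_nonneg _), abs_mul, abs_of_nonneg this, mul_comm]
    · rw [indicator_of_notMem ht, indicator_of_notMem]
      exact fun h => ht h.2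
  · rw [indicator_of_notMem ha]
    refine (lintegral_congr fun t => ?_).trans lintegral_zero
    exact indicator_of_notMem (fun h => ha h.1) _

theorem IsGraphDirection.inter_openCone_eq (hU : IsGraphDirection Ω U e c)
    (hΩ : IsConvexDomain Ω) {A Z : Set (EuclideanSpace ℝ (Fin n))} (hA : A ⊆ U ∩ frontier Ω) :
    openCone A ∩ Z =
      (fun y => (1 + height Ω U e y) • foot Ω U e y) '' coneDomain Ω U e A Z := by
  ext x
  constructor
  · rintro ⟨⟨a, ha, t, ht, rfl⟩, hZ⟩
    have h1 : foot Ω U e (a + (t - 1) • e) = a := by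
      rw [hU.foot_add_smul hΩ, hU.foot_eq_self hΩ (hA ha)]
    have h2 : 1 + height Ω U e (a + (t - 1) • e) = t := by
      rw [hU.height_add_smul hΩ, hU.height_eq_zero hΩ (hA ha)]; ring
    refine ⟨a + (t - 1) • e, ⟨?_, ?_, ?_⟩, ?_⟩
    · rwa [h1]
    · rwa [h2]
    · rwa [h1, h2]
    · simp only [h1, h2]
  · rintro ⟨y, ⟨h1, h2, h3⟩, rfl⟩
    exact ⟨⟨_, h1, _, h2, rfl⟩, h3⟩

/-- The cone over a part of the patch has at most the volume given by the area formula; a point of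
the cone may be reached from several points of the patch. -/
theorem IsGraphDirection.volume_openCone_inter_le (hU : IsGraphDirection Ω U e c)
    (hΩ : IsConvexDomain Ω) (hn : 1 ≤ n) {A Z : Set (EuclideanSpace ℝ (Fin n))}
    (hA : MeasurableSet A) (hZ : MeasurableSet Z) (hAU : A ⊆ U ∩ frontier Ω)
    (hd : ∀ a ∈ A, DifferentiableAt ℝ (height Ω U e) a) :
    volume (openCone A ∩ Z) ≤
      ∫⁻ a in A, ENNReal.ofReal |fderiv ℝ (height Ω U e) a a| * coneWeight Z a
        ∂graphMeasure Ω U e := by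
  have h : ∀ x : coneDomain Ω U e A Z, _ := fun x =>
    hU.exists_hasFDerivAt_coneMap hΩ hn (hAU x.2.1) (hd _ x.2.1) x.2.2.1.1.ne'
  choose D hD hdet using h
  classical
  let D' : EuclideanSpace ℝ (Fin n) → EuclideanSpace ℝ (Fin n) →L[ℝ] EuclideanSpace ℝ (Fin n) :=
    fun x => if hx : x ∈ coneDomain Ω U e A Z then D ⟨x, hx⟩ else 0
  have hm := hU.measurableSet_coneDomain hΩ hA hZ
  rw [hU.inter_openCone_eq hΩ hAU, ← hU.lintegral_coneDomain hΩ hA hZ]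
  refine (addHaar_image_le_lintegral_abs_det_fderiv volume hm (f' := D') fun x hx => ?_).trans_eq ?_
  · simp only [D', dif_pos hx]
    exact (hD ⟨x, hx⟩).hasFDerivWithinAt
  · refine setLIntegral_congr_fun hm fun x hx => ?_
    simp only [D', dif_pos hx]
    rw [hdet ⟨x, hx⟩]

/-- The area formula for the cone over a part of the patch that every ray from `0` meets at most
once. -/
theorem IsGraphDirection.volume_openCone_eq (hU : IsGraphDirection Ω U e c)
    (hΩ : IsConvexDomain Ω) (hn : 1 ≤ n) {A : Set (EuclideanSpace ℝ (Fin n))}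
    (hA : MeasurableSet A) (hAU : A ⊆ U ∩ frontier Ω)
    (hd : ∀ a ∈ A, DifferentiableAt ℝ (height Ω U e) a)
    (hinj : ∀ a ∈ A, ∀ b ∈ A, ∀ t ∈ Ioo (0 : ℝ) 1, ∀ s ∈ Ioo (0 : ℝ) 1,
      t • a = s • b → t = s ∧ a = b) :
    MeasurableSet (openCone A) ∧ volume (openCone A) =
      ∫⁻ a in A, ENNReal.ofReal |fderiv ℝ (height Ω U e) a a| * coneWeight univ a
        ∂graphMeasure Ω U e := by
  have h : ∀ x : coneDomain Ω U e A univ, _ := fun x =>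
    hU.exists_hasFDerivAt_coneMap hΩ hn (hAU x.2.1) (hd _ x.2.1) x.2.2.1.1.ne'
  choose D hD hdet using h
  classical
  let D' : EuclideanSpace ℝ (Fin n) → EuclideanSpace ℝ (Fin n) →L[ℝ] EuclideanSpace ℝ (Fin n) :=
    fun x => if hx : x ∈ coneDomain Ω U e A univ then D ⟨x, hx⟩ else 0
  have hm := hU.measurableSet_coneDomain hΩ hA MeasurableSet.univ
  have hi : InjOn (fun y => (1 + height Ω U e y) • foot Ω U e y) (coneDomain Ω U e A univ) := by
    rintro x ⟨hx1, hx2, -⟩ y ⟨hy1, hy2, -⟩ hxy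
    obtain ⟨h1, h2⟩ := hinj _ hx1 _ hy1 _ hx2 _ hy2 hxy
    have h3 : ∀ z, z = foot Ω U e z + height Ω U e z • e := fun z => by rw [foot]; abel
    rw [h3 x, h3 y, h2, add_left_cancel h1]
  have hD' : ∀ x ∈ coneDomain Ω U e A univ,
      HasFDerivWithinAt (fun y => (1 + height Ω U e y) • foot Ω U e y) (D' x)
        (coneDomain Ω U e A univ) x := fun x hx => by
    simp only [D', dif_pos hx]
    exact (hD ⟨x, hx⟩).hasFDerivWithinAt
  rw [← inter_univ (openCone A), hU.inter_openCone_eq hΩ hAU,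
    ← hU.lintegral_coneDomain hΩ hA MeasurableSet.univ,
    ← lintegral_abs_det_fderiv_eq_addHaar_image volume hm hD' hi]
  refine ⟨measurable_image_of_fderivWithin hm hD' hi, setLIntegral_congr_fun hm fun x hx => ?_⟩
  simp only [D', dif_pos hx]
  rw [hdet ⟨x, hx⟩]

end Cone

/-! ### Surface measure and normals of the whole boundary -/

section Global

variable {n : ℕ} {Ω U : Set (EuclideanSpace ℝ (Fin n))} {e : EuclideanSpace ℝ (Fin n)} {c : ℝ}

/-- A cover by open sets with a property `P` has a countable subcover. The empty set is allowed as a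
member, whether or not it satisfies `P`, so that the subcover can be indexed by `ℕ`. -/
theorem exists_seq_isOpen_cover {s : Set (EuclideanSpace ℝ (Fin n))}
    {P : Set (EuclideanSpace ℝ (Fin n)) → Prop} (h : ∀ x ∈ s, ∃ U, IsOpen U ∧ x ∈ U ∧ P U) :
    ∃ u : ℕ → Set (EuclideanSpace ℝ (Fin n)),
      (∀ i, IsOpen (u i) ∧ (P (u i) ∨ u i = ∅)) ∧ s ⊆ ⋃ i, u i := by
  choose! f hfo hfx hfP using h
  obtain ⟨t, hts, htc, hst⟩ := TopologicalSpace.countable_cover_nhdsWithin (s := s) (f := f)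
    fun x hx => mem_nhdsWithin_of_mem_nhds ((hfo x hx).mem_nhds (hfx x hx))
  rcases t.eq_empty_or_nonempty with rfl | hne
  · exact ⟨fun _ => ∅, fun _ => ⟨isOpen_empty, Or.inr rfl⟩, by simpa using hst⟩
  · obtain ⟨g, hg⟩ := htc.exists_eq_range hne
    have hgt : ∀ i, g i ∈ s := fun i => hts (hg ▸ mem_range_self i)
    refine ⟨fun i => f (g i), fun i => ⟨hfo _ (hgt i), Or.inl (hfP _ (hgt i))⟩, ?_⟩
    rwa [hg, biUnion_range] at hst

theorem IsGraphDirection.euclideanHausdorffMeasure_not_differentiableAt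
    (hU : IsGraphDirection Ω U e c) (hΩ : IsConvexDomain Ω) (hUo : IsOpen U) :
    μHE[n - 1] (U ∩ frontier Ω ∩ {a | ¬ DifferentiableAt ℝ (height Ω U e) a}) = 0 := by
  have hm : MeasurableSet (U ∩ frontier Ω ∩ {a | ¬ DifferentiableAt ℝ (height Ω U e) a}) :=
    (hUo.measurableSet.inter isClosed_frontier.measurableSet).inter
      (measurableSet_of_differentiableAt ℝ (height Ω U e)).compl
  refine le_antisymm ((hU.euclideanHausdorffMeasure_le hΩ hm inter_subset_left).trans ?_)
    zero_le
  rw [measure_mono_null inter_subset_right (hU.graphMeasure_not_differentiableAt hΩ), mul_zero]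

theorem IsConvexDomain.euclideanHausdorffMeasure_frontier_lt_top (hΩ : IsConvexDomain Ω) :
    μHE[n - 1] (frontier Ω) < ⊤ := by
  have hcpt : IsCompact (frontier Ω) :=
    Metric.isCompact_of_isClosed_isBounded isClosed_frontier
      (hΩ.isBounded.closure.subset frontier_subset_closure)
  refine hcpt.measure_lt_top_of_nhdsWithin fun x hx => ?_
  obtain ⟨U, e, c, hUo, hxU, hU⟩ := hΩ.exists_isGraphDirection hx
  have hm : MeasurableSet (U ∩ frontier Ω) :=
    hUo.measurableSet.inter isClosed_frontier.measurableSet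
  refine ⟨U ∩ frontier Ω, Filter.inter_mem (mem_nhdsWithin_of_mem_nhds (hUo.mem_nhds hxU))
    self_mem_nhdsWithin, (hU.euclideanHausdorffMeasure_le hΩ hm subset_rfl).trans_lt ?_⟩
  refine ENNReal.mul_lt_top (ENNReal.pow_lt_top ENNReal.ofReal_lt_top) ?_
  rw [graphMeasure, Measure.map_apply (hU.measurable_foot_coe hΩ) hm]
  obtain ⟨R, hR⟩ := hcpt.isBounded.exists_norm_le
  refine (measure_mono fun y hy => ?_).trans_lt
    (measure_closedBall_lt_top (x := (0 : (ℝ ∙ e)ᗮ)) (r := R))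
  have h1 : ‖foot Ω U e y‖ ≤ R := hR _ hy.2
  have h2 : ‖(y : EuclideanSpace ℝ (Fin n))‖ ^ 2 ≤ ‖foot Ω U e y‖ ^ 2 := by
    rw [foot, norm_sub_sq_real, inner_smul_right, inner_orthogonal_eq_zero]
    nlinarith [sq_nonneg ‖height Ω U e y • e‖]
  rw [mem_closedBall_zero_iff]
  exact (le_of_sq_le_sq h2 (norm_nonneg _)).trans h1

/-- Almost every boundary point of a convex domain has a unique outward normal. -/
theorem IsConvexDomain.euclideanHausdorffMeasure_not_existsUnique (hΩ : IsConvexDomain Ω) :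
    μHE[n - 1] {x ∈ frontier Ω | ¬ ∃! ν, IsOutwardUnitNormal Ω x ν} = 0 := by
  refine measure_null_of_locally_null _ fun x hx => ?_
  obtain ⟨U, e, c, hUo, hxU, hU⟩ := hΩ.exists_isGraphDirection hx.1
  refine ⟨_, Filter.inter_mem (mem_nhdsWithin_of_mem_nhds (hUo.mem_nhds hxU))
    self_mem_nhdsWithin, measure_mono_null ?_
    (hU.euclideanHausdorffMeasure_not_differentiableAt hΩ hUo)⟩
  rintro y ⟨hyU, hyf, hy⟩
  exact ⟨⟨hyU, hyf⟩, fun hd => hy (hU.existsUnique_normal hΩ ⟨hyU, hyf⟩ hd)⟩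

theorem IsConvexDomain.ae_norm_outwardNormal (hΩ : IsConvexDomain Ω) :
    ∀ᵐ x ∂(μHE[n - 1] : Measure (EuclideanSpace ℝ (Fin n))).restrict (frontier Ω),
      ‖outwardNormal Ω x‖ = 1 := by
  rw [ae_restrict_iff' isClosed_frontier.measurableSet]
  refine measure_mono_null (fun x hx => ?_) hΩ.euclideanHausdorffMeasure_not_existsUnique
  have hx' : ¬ (x ∈ frontier Ω → ‖outwardNormal Ω x‖ = 1) := hx
  push Not at hx'
  refine ⟨hx'.1, fun h => hx'.2 ?_⟩
  obtain ⟨ν, hν⟩ := h.exists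
  rw [outwardNormal_eq h hν, hν.1]

theorem IsConvexDomain.aemeasurable_outwardNormal (hΩ : IsConvexDomain Ω) :
    AEMeasurable (outwardNormal Ω)
      ((μHE[n - 1] : Measure (EuclideanSpace ℝ (Fin n))).restrict (frontier Ω)) := by
  obtain ⟨u, hu, hcov⟩ := exists_seq_isOpen_cover
    (P := fun U => ∃ e c, IsGraphDirection Ω U e c) fun x hx => by
      obtain ⟨U, e, c, hUo, hxU, hU⟩ := hΩ.exists_isGraphDirection hx
      exact ⟨U, hUo, hxU, e, c, hU⟩
  have hcov' : frontier Ω = ⋃ i, u i ∩ frontier Ω := by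
    rw [← iUnion_inter]; exact (inter_eq_right.2 hcov).symm
  rw [hcov', aemeasurable_iUnion_iff]
  intro i
  rcases (hu i).2 with ⟨e, c, hU⟩ | h0
  swap
  · simp [h0]
  have hm : MeasurableSet (u i ∩ frontier Ω) :=
    (hu i).1.measurableSet.inter isClosed_frontier.measurableSet
  let g : EuclideanSpace ℝ (Fin n) → EuclideanSpace ℝ (Fin n) := fun a =>
    (InnerProductSpace.toDual ℝ (EuclideanSpace ℝ (Fin n))).symm (fderiv ℝ (height Ω (u i) e) a)
  have hg : Measurable g :=
    (InnerProductSpace.toDual ℝ (EuclideanSpace ℝ (Fin n))).symm.continuous.measurable.comp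
      (measurable_fderiv ℝ _)
  refine ⟨fun a => ‖g a‖⁻¹ • g a, hg.norm.inv.smul hg, ?_⟩
  rw [Filter.EventuallyEq, ae_restrict_iff' hm]
  refine measure_mono_null (fun a ha => ?_)
    (hU.euclideanHausdorffMeasure_not_differentiableAt hΩ (hu i).1)
  have ha' : ¬ (a ∈ u i ∩ frontier Ω → outwardNormal Ω a = ‖g a‖⁻¹ • g a) := ha
  push Not at ha'
  refine ⟨ha'.1, fun hd => ha'.2 ?_⟩
  have h := hU.existsUnique_normal hΩ ha'.1 hd
  obtain ⟨ν, hν⟩ := h.exists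
  have hp := hU.pos.trans_le (hU.le_inner a ha'.1 ν hν)
  have hga : g a = (⟪ν, e⟫)⁻¹ • ν := by
    refine ext_inner_right ℝ fun v => ?_
    rw [InnerProductSpace.toDual_symm_apply, hU.fderiv_height hΩ ha'.1 hν hd,
      real_inner_smul_left, div_eq_inv_mul]
  rw [outwardNormal_eq h hν, hga, norm_smul, hν.1, mul_one, norm_inv, Real.norm_of_nonneg hp.le,
    inv_inv, smul_smul, mul_inv_cancel₀ hp.ne', one_smul]

/-! ### The area formula for cones over the boundary -/

theorem openCone_mono {A B : Set (EuclideanSpace ℝ (Fin n))} (h : A ⊆ B) :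
    openCone A ⊆ openCone B := fun _ ⟨a, ha, t, ht, hx⟩ => ⟨a, h ha, t, ht, hx⟩

theorem openCone_iUnion {ι : Type*} (A : ι → Set (EuclideanSpace ℝ (Fin n))) :
    openCone (⋃ i, A i) = ⋃ i, openCone (A i) := by
  ext x
  simp only [openCone, mem_iUnion, mem_ofPred_eq]
  constructor
  · rintro ⟨a, ⟨i, hi⟩, h⟩; exact ⟨i, a, hi, h⟩
  · rintro ⟨i, a, hi, h⟩; exact ⟨a, ⟨i, hi⟩, h⟩

theorem openCone_union (A B : Set (EuclideanSpace ℝ (Fin n))) :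
    openCone (A ∪ B) = openCone A ∪ openCone B := by
  ext x
  simp only [openCone, mem_union, mem_ofPred_eq]
  constructor
  · rintro ⟨a, h1 | h1, h⟩
    exacts [Or.inl ⟨a, h1, h⟩, Or.inr ⟨a, h1, h⟩]
  · rintro (⟨a, h1, h⟩ | ⟨a, h1, h⟩)
    exacts [⟨a, Or.inl h1, h⟩, ⟨a, Or.inr h1, h⟩]

/-- The cone over a null set is null. The height need not be differentiable at any point of `N`, so
this rests on the Lipschitz bound for the cone map in place of the area formula. -/
theorem IsGraphDirection.volume_openCone_eq_zero (hU : IsGraphDirection Ω U e c)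
    (hΩ : IsConvexDomain Ω) {N : Set (EuclideanSpace ℝ (Fin n))} (hN : MeasurableSet N)
    (hNU : N ⊆ U ∩ frontier Ω) (h0 : graphMeasure Ω U e N = 0) : volume (openCone N) = 0 := by
  have hdom : volume (coneDomain Ω U e N univ) = 0 := by
    let S : Set (EuclideanSpace ℝ (Fin n) × ℝ) := {q | q.1 ∈ N ∧ q.2 ∈ Ioo (0 : ℝ) 1}
    have hS : MeasurableSet S := (measurable_fst hN).inter (measurable_snd measurableSet_Ioo)
    have h1 := hU.lintegral_foot_height hΩ
      ((measurable_const (a := (1 : ENNReal))).indicator hS)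
    have h2 : ∀ x, S.indicator (fun _ => (1 : ENNReal)) (foot Ω U e x, 1 + height Ω U e x) =
        (coneDomain Ω U e N univ).indicator 1 x := by
      intro x
      have h3 : (foot Ω U e x, 1 + height Ω U e x) ∈ S ↔ x ∈ coneDomain Ω U e N univ := by
        simp [S, coneDomain]
      by_cases h4 : x ∈ coneDomain Ω U e N univ
      · rw [indicator_of_mem h4, indicator_of_mem (h3.2 h4), Pi.one_apply]
      · rw [indicator_of_notMem h4, indicator_of_notMem (mt h3.1 h4)]
    simp only [h2] at h1
    rw [lintegral_indicator_one (hU.measurableSet_coneDomain hΩ hN MeasurableSet.univ)] at h1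
    rw [h1]
    refine (lintegral_congr_ae (g := fun _ => 0) ?_).trans lintegral_zero
    refine measure_mono_null (fun a ha => ?_) h0
    by_contra hcon
    apply ha
    refine (lintegral_congr fun t => ?_).trans lintegral_zero
    exact indicator_of_notMem (fun h => hcon h.1) _
  obtain ⟨R, hR⟩ := hΩ.isBounded.closure.exists_norm_le
  have hc : 0 ≤ c⁻¹ := inv_nonneg.2 hU.pos.le
  have hlip : LipschitzOnWith (Real.toNNReal (1 + c⁻¹ + c⁻¹ * R))
      (fun y => (1 + height Ω U e y) • foot Ω U e y) (coneDomain Ω U e N univ) := by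
    refine LipschitzOnWith.of_dist_le_mul fun x hx y hy => ?_
    have hR0 : ‖foot Ω U e y‖ ≤ R := hR _ (frontier_subset_closure (hNU hy.1).2)
    have hR1 : 0 ≤ R := (norm_nonneg _).trans hR0
    rw [Real.coe_toNNReal _ (by positivity), dist_eq_norm, dist_eq_norm]
    have h1 : |height Ω U e x - height Ω U e y| ≤ c⁻¹ * ‖x - y‖ := by
      have := (hU.lipschitzWith_height hΩ).dist_le_mul x y
      rwa [Real.coe_toNNReal _ hc, Real.dist_eq, dist_eq_norm] at this
    have h2 : ‖foot Ω U e x - foot Ω U e y‖ ≤ (1 + c⁻¹) * ‖x - y‖ := by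
      have : foot Ω U e x - foot Ω U e y =
          (x - y) - (height Ω U e x - height Ω U e y) • e := by
        rw [foot, foot, sub_smul]; abel
      rw [this]
      refine (_root_.norm_sub_le _ _).trans ?_
      rw [norm_smul, hU.norm_eq, Real.norm_eq_abs]
      linarith
    have h3 : (1 + height Ω U e x) • foot Ω U e x - (1 + height Ω U e y) • foot Ω U e y =
        (1 + height Ω U e x) • (foot Ω U e x - foot Ω U e y) +
          (height Ω U e x - height Ω U e y) • foot Ω U e y := by
      module
    have h4 : |1 + height Ω U e x| ≤ 1 := by
      rw [abs_of_pos hx.2.1.1]; exact hx.2.1.2.le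
    rw [h3]
    refine (norm_add_le _ _).trans ?_
    rw [norm_smul, norm_smul, Real.norm_eq_abs, Real.norm_eq_abs]
    have h5 : |1 + height Ω U e x| * ‖foot Ω U e x - foot Ω U e y‖ ≤
        1 * ((1 + c⁻¹) * ‖x - y‖) := by gcongr
    have h6 : |height Ω U e x - height Ω U e y| * ‖foot Ω U e y‖ ≤ (c⁻¹ * ‖x - y‖) * R := by
      gcongr
    linarith
  rw [← inter_univ (openCone N), hU.inter_openCone_eq hΩ hNU,
    ← EuclideanSpace.euclideanHausdorffMeasure_eq_volume]
  refine le_antisymm ((hlip.euclideanHausdorffMeasure_image_le n).trans ?_) zero_le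
  rw [EuclideanSpace.euclideanHausdorffMeasure_eq_volume, hdom, mul_zero]

/-- The cone inequality on one patch, up to the factor `c⁻¹`. -/
theorem IsGraphDirection.volume_openCone_inter_le_outwardNormal (hU : IsGraphDirection Ω U e c)
    (hΩ : IsConvexDomain Ω) (hn : 1 ≤ n) {A Z : Set (EuclideanSpace ℝ (Fin n))}
    (hA : MeasurableSet A) (hZ : MeasurableSet Z) (hAU : A ⊆ U ∩ frontier Ω) :
    volume (openCone A ∩ Z) ≤ ENNReal.ofReal c⁻¹ *
      ∫⁻ a in A, ENNReal.ofReal |⟪outwardNormal Ω a, a⟫| * coneWeight Z a ∂μHE[n - 1] := by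
  set N := {a | ¬ DifferentiableAt ℝ (height Ω U e) a} with hN
  have hNm : MeasurableSet N := (measurableSet_of_differentiableAt ℝ (height Ω U e)).compl
  have h1 : volume (openCone (A ∩ N)) = 0 :=
    hU.volume_openCone_eq_zero hΩ (hA.inter hNm) (inter_subset_left.trans hAU)
      (measure_mono_null inter_subset_right (hU.graphMeasure_not_differentiableAt hΩ))
  have hd : ∀ a ∈ A \ N, DifferentiableAt ℝ (height Ω U e) a := fun a ha => not_not.1 ha.2
  have h2 := hU.volume_openCone_inter_le hΩ hn (hA.diff hNm) hZ (sdiff_subset.trans hAU) hd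
  have h3 : openCone A ∩ Z ⊆ openCone (A ∩ N) ∪ (openCone (A \ N) ∩ Z) := by
    rintro x ⟨hx, hxZ⟩
    rw [← inter_union_sdiff A N, openCone_union] at hx
    exact hx.imp id fun h => ⟨h, hxZ⟩
  calc volume (openCone A ∩ Z) ≤ volume (openCone (A ∩ N)) + volume (openCone (A \ N) ∩ Z) :=
        (measure_mono h3).trans (measure_union_le _ _)
    _ ≤ ∫⁻ a in A \ N, ENNReal.ofReal |fderiv ℝ (height Ω U e) a a| * coneWeight Z a
        ∂graphMeasure Ω U e := by rw [h1, zero_add]; exact h2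
    _ ≤ ∫⁻ a in A \ N, ENNReal.ofReal c⁻¹ *
        (ENNReal.ofReal |⟪outwardNormal Ω a, a⟫| * coneWeight Z a) ∂graphMeasure Ω U e := by
        refine setLIntegral_mono' (hA.diff hNm) fun a ha => ?_
        rw [← mul_assoc, ← ENNReal.ofReal_mul (inv_nonneg.2 hU.pos.le),
          hU.fderiv_height_eq_outwardNormal hΩ (hAU ha.1) (hd a ha)]
        have h5 := hU.le_inner_outwardNormal hΩ (hAU ha.1) (hd a ha)
        gcongr
        rw [abs_div, div_eq_inv_mul]
        have h6 := hU.pos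
        rw [abs_of_pos (h6.trans_le h5)]
        gcongr
    _ ≤ ∫⁻ a in A, ENNReal.ofReal c⁻¹ *
        (ENNReal.ofReal |⟪outwardNormal Ω a, a⟫| * coneWeight Z a) ∂μHE[n - 1] :=
        lintegral_mono' (Measure.restrict_mono sdiff_subset
          (Measure.le_iff.2 fun s hs => hU.graphMeasure_le hΩ hs)) le_rfl
    _ = _ := lintegral_const_mul' _ _ ENNReal.ofReal_ne_top

theorem IsConvexDomain.volume_openCone_eq_zero (hΩ : IsConvexDomain Ω) (hn : 1 ≤ n)
    {A : Set (EuclideanSpace ℝ (Fin n))} (hA : MeasurableSet A) (hAΩ : A ⊆ frontier Ω)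
    (h0 : μHE[n - 1] A = 0) : volume (openCone A) = 0 := by
  obtain ⟨u, hu, hcov⟩ := exists_seq_isOpen_cover
    (P := fun U => ∃ e c, IsGraphDirection Ω U e c) fun x hx => by
      obtain ⟨U, e, c, hUo, hxU, hU⟩ := hΩ.exists_isGraphDirection hx
      exact ⟨U, hUo, hxU, e, c, hU⟩
  have hcov' : A = ⋃ i, u i ∩ A := by
    rw [← iUnion_inter]; exact (inter_eq_right.2 (hAΩ.trans hcov)).symm
  rw [hcov', openCone_iUnion]
  refine measure_iUnion_null fun i => ?_
  rcases (hu i).2 with ⟨e, c, hU⟩ | h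
  · have h1 := hU.volume_openCone_inter_le_outwardNormal hΩ hn
      ((hu i).1.measurableSet.inter hA) MeasurableSet.univ (inter_subset_inter_right _ hAΩ)
    rw [inter_univ, setLIntegral_measure_zero _ _ (measure_mono_null inter_subset_right h0),
      mul_zero] at h1
    exact le_antisymm h1 zero_le
  · simp [h, openCone]

theorem le_of_forall_lt_one_le_ofReal_inv_pow_mul {x y : ENNReal} (k : ℕ)
    (h : ∀ c : ℝ, 0 < c → c < 1 → x ≤ ENNReal.ofReal c⁻¹ ^ k * y) : x ≤ y := by
  have h1 : Filter.Tendsto (fun c : ℝ => ENNReal.ofReal c⁻¹ ^ k * y) (nhdsWithin 1 (Iio 1))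
      (nhds (1 * y)) := by
    refine ENNReal.Tendsto.mul_const ?_ (Or.inl one_ne_zero)
    have h2 : Filter.Tendsto (fun c : ℝ => c⁻¹) (nhdsWithin 1 (Iio 1)) (nhds 1) := by
      have := (tendsto_inv₀ (one_ne_zero (α := ℝ))).mono_left
        (nhdsWithin_le_nhds (s := Iio (1 : ℝ)))
      rwa [inv_one] at this
    have h3 := ENNReal.Tendsto.pow (n := k) (ENNReal.tendsto_ofReal h2)
    rwa [ENNReal.ofReal_one, one_pow] at h3
  rw [one_mul] at h1
  refine ge_of_tendsto h1 ?_
  filter_upwards [Ioo_mem_nhdsLT (show (0 : ℝ) < 1 by norm_num)] with c hc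
  exact h c hc.1 hc.2

/-- **Cone inequality.** The part in `Z` of the cone over `A ⊆ frontier Ω` is at most the sum of the
volumes of the infinitesimal cones over the surface elements of `A`. -/
theorem IsConvexDomain.volume_openCone_inter_le (hΩ : IsConvexDomain Ω) (hn : 1 ≤ n)
    {A Z : Set (EuclideanSpace ℝ (Fin n))} (hA : MeasurableSet A) (hZ : MeasurableSet Z)
    (hAΩ : A ⊆ frontier Ω) :
    volume (openCone A ∩ Z) ≤
      ∫⁻ a in A, ENNReal.ofReal |⟪outwardNormal Ω a, a⟫| * coneWeight Z a ∂μHE[n - 1] := by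
  -- almost all of the boundary is covered by patches so flat that the inequality holds on each of
  -- them up to the factor `c⁻¹`, where `c < 1` is arbitrary
  refine le_of_forall_lt_one_le_ofReal_inv_pow_mul 1 fun c hc0 hc1 => ?_
  rw [pow_one]
  obtain ⟨u, hu, hcov⟩ := exists_seq_isOpen_cover
    (s := {x ∈ frontier Ω | ∃! ν, IsOutwardUnitNormal Ω x ν})
    (P := fun U => ∃ e, IsGraphDirection Ω U e c) fun x hx => by
      obtain ⟨U, e, hUo, hxU, hU⟩ := exists_isGraphDirection_of_existsUnique hx.1 hx.2 hc0 hc1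
      exact ⟨U, hUo, hxU, e, hU⟩
  have hum : ∀ i, MeasurableSet (disjointed u i) :=
    MeasurableSet.disjointed fun i => (hu i).1.measurableSet
  have hAm : ∀ i, MeasurableSet (A ∩ disjointed u i) := fun i => hA.inter (hum i)
  set B := A \ ⋃ i, u i with hB
  have hBm : MeasurableSet B := hA.diff (MeasurableSet.iUnion fun i => (hu i).1.measurableSet)
  have hB0 : volume (openCone B) = 0 := by
    refine hΩ.volume_openCone_eq_zero hn hBm (sdiff_subset.trans hAΩ)
      (measure_mono_null (fun x hx => ?_) hΩ.euclideanHausdorffMeasure_not_existsUnique)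
    exact ⟨hAΩ hx.1, fun h => hx.2 (hcov ⟨hAΩ hx.1, h⟩)⟩
  have hAeq : A = (⋃ i, A ∩ disjointed u i) ∪ B := by
    rw [← inter_iUnion, iUnion_disjointed, hB, inter_union_sdiff]
  have hsub : openCone A ∩ Z ⊆ (⋃ i, openCone (A ∩ disjointed u i) ∩ Z) ∪ openCone B := by
    rintro x ⟨hx, hxZ⟩
    rw [hAeq, openCone_union, openCone_iUnion] at hx
    refine hx.imp (fun h => ?_) id
    rw [← iUnion_inter]
    exact ⟨h, hxZ⟩
  let f : EuclideanSpace ℝ (Fin n) → ENNReal := fun a =>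
    ENNReal.ofReal |⟪outwardNormal Ω a, a⟫| * coneWeight Z a
  have hloc : ∀ i, volume (openCone (A ∩ disjointed u i) ∩ Z) ≤
      ENNReal.ofReal c⁻¹ * ∫⁻ a in A ∩ disjointed u i, f a ∂μHE[n - 1] := by
    intro i
    rcases (hu i).2 with ⟨e, hU⟩ | h
    · exact hU.volume_openCone_inter_le_outwardNormal hΩ hn (hAm i) hZ
        fun x hx => ⟨disjointed_subset _ _ hx.2, hAΩ hx.1⟩
    · have : A ∩ disjointed u i = ∅ := by
        refine eq_empty_of_subset_empty fun x hx => ?_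
        have := disjointed_subset u i hx.2
        rwa [h] at this
      simp [this, openCone]
  calc volume (openCone A ∩ Z)
      ≤ (∑' i, volume (openCone (A ∩ disjointed u i) ∩ Z)) + volume (openCone B) :=
        (measure_mono hsub).trans ((measure_union_le _ _).trans
          (add_le_add (measure_iUnion_le _) le_rfl))
    _ ≤ ∑' i, ENNReal.ofReal c⁻¹ * ∫⁻ a in A ∩ disjointed u i, f a ∂μHE[n - 1] := by
        rw [hB0, add_zero]; exact ENNReal.tsum_le_tsum hloc
    _ = ENNReal.ofReal c⁻¹ * ∫⁻ a in ⋃ i, A ∩ disjointed u i, f a ∂μHE[n - 1] := by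
        rw [ENNReal.tsum_mul_left, lintegral_iUnion hAm
          (pairwise_disjoint_mono (disjoint_disjointed u) fun i => inter_subset_right)]
    _ ≤ ENNReal.ofReal c⁻¹ * ∫⁻ a in A, f a ∂μHE[n - 1] := by
        gcongr
        exact iUnion_subset fun i => inter_subset_left

theorem lintegral_Ioo_pow (hn : 1 ≤ n) {a b : ℝ} (ha : 0 ≤ a) (hab : a ≤ b) :
    ∫⁻ t in Ioo a b, ENNReal.ofReal (t ^ (n - 1)) = ENNReal.ofReal ((b ^ n - a ^ n) / n) := by
  rw [restrict_Ioo_eq_restrict_Ioc, ← ofReal_integral_eq_lintegral_ofReal,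
    ← intervalIntegral.integral_of_le hab, integral_pow]
  · congr 1
    obtain ⟨m, rfl⟩ : ∃ m, n = m + 1 := ⟨n - 1, by omega⟩
    simp
  · exact (continuous_pow (n - 1)).integrableOn_Ioc
  · rw [Filter.EventuallyLE, ae_restrict_iff' measurableSet_Ioc]
    exact Filter.Eventually.of_forall fun t ht => pow_nonneg (ha.trans ht.1.le) _

theorem coneWeight_univ (hn : 1 ≤ n) (a : EuclideanSpace ℝ (Fin n)) :
    coneWeight univ a = ENNReal.ofReal (1 / n) := by
  have h1 : {t : ℝ | t ∈ Ioo (0 : ℝ) 1 ∧ t • a ∈ univ} = Ioo 0 1 := by ext; simp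
  rw [coneWeight, h1, lintegral_Ioo_pow hn le_rfl zero_le_one, one_pow, zero_pow (by omega),
    sub_zero]

/-- **Reverse cone inequality**, for a boundary that every ray from `0` meets at most once. -/
theorem IsConvexDomain.lintegral_outwardNormal_le (hΩ : IsConvexDomain Ω) (hn : 1 ≤ n)
    {A : Set (EuclideanSpace ℝ (Fin n))} (hA : MeasurableSet A) (hAΩ : A ⊆ frontier Ω)
    (hinj : ∀ a ∈ A, ∀ b ∈ A, ∀ t ∈ Ioo (0 : ℝ) 1, ∀ s ∈ Ioo (0 : ℝ) 1,
      t • a = s • b → t = s ∧ a = b) :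
    ∫⁻ a in A, ENNReal.ofReal |⟪outwardNormal Ω a, a⟫| ∂μHE[n - 1] ≤
      n * volume (openCone A) := by
  -- on a patch of slope controlled by `c` surface measure exceeds the projected measure at most by
  -- the factor `c⁻¹ ^ (n - 1)`
  refine le_of_forall_lt_one_le_ofReal_inv_pow_mul (n - 1) fun c hc0 hc1 => ?_
  obtain ⟨u, hu, hcov⟩ := exists_seq_isOpen_cover
    (s := {x ∈ frontier Ω | ∃! ν, IsOutwardUnitNormal Ω x ν})
    (P := fun U => ∃ e, IsGraphDirection Ω U e c) fun x hx => by
      obtain ⟨U, e, hUo, hxU, hU⟩ := exists_isGraphDirection_of_existsUnique hx.1 hx.2 hc0 hc1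
      exact ⟨U, hUo, hxU, e, hU⟩
  have hum : ∀ i, MeasurableSet (disjointed u i) :=
    MeasurableSet.disjointed fun i => (hu i).1.measurableSet
  have hAm : ∀ i, MeasurableSet (A ∩ disjointed u i) := fun i => hA.inter (hum i)
  let f : EuclideanSpace ℝ (Fin n) → ENNReal := fun a => ENNReal.ofReal |⟪outwardNormal Ω a, a⟫|
  set κ : ENNReal := ENNReal.ofReal c⁻¹ ^ (n - 1) with hκ
  have hκtop : κ ≠ ⊤ := ENNReal.pow_ne_top ENNReal.ofReal_ne_top
  -- on each patch only the points of differentiability of the height count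
  have hloc : ∀ i, ∃ A' ⊆ A ∩ disjointed u i, MeasurableSet (openCone A') ∧
      ∫⁻ a in A ∩ disjointed u i, f a ∂μHE[n - 1] ≤ κ * (n * volume (openCone A')) := by
    intro i
    rcases (hu i).2 with ⟨e, hU⟩ | h
    · set N := {a | ¬ DifferentiableAt ℝ (height Ω (u i) e) a} with hN
      have hNm : MeasurableSet N :=
        (measurableSet_of_differentiableAt ℝ (height Ω (u i) e)).compl
      have hsub : A ∩ disjointed u i ⊆ u i ∩ frontier Ω :=
        fun x hx => ⟨disjointed_subset _ _ hx.2, hAΩ hx.1⟩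
      set A' := (A ∩ disjointed u i) \ N with hA'
      have hA'm : MeasurableSet A' := (hAm i).diff hNm
      have hA'sub : A' ⊆ u i ∩ frontier Ω := sdiff_subset.trans hsub
      have hd : ∀ a ∈ A', DifferentiableAt ℝ (height Ω (u i) e) a := fun a ha => not_not.1 ha.2
      obtain ⟨hm, hvol⟩ := hU.volume_openCone_eq hΩ hn hA'm hA'sub hd fun a ha b hb =>
        hinj a ha.1.1 b hb.1.1
      refine ⟨A', sdiff_subset, hm, ?_⟩
      have h0 : μHE[n - 1] ((A ∩ disjointed u i) ∩ N) = 0 :=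
        measure_mono_null (inter_subset_inter_left _ hsub)
          (hU.euclideanHausdorffMeasure_not_differentiableAt hΩ (hu i).1)
      have hle : (μHE[n - 1] : Measure (EuclideanSpace ℝ (Fin n))).restrict A' ≤
          κ • (graphMeasure Ω (u i) e).restrict A' := by
        refine Measure.le_iff.2 fun s hs => ?_
        rw [Measure.smul_apply, Measure.restrict_apply hs, Measure.restrict_apply hs, smul_eq_mul]
        exact hU.euclideanHausdorffMeasure_le hΩ (hs.inter hA'm) (inter_subset_right.trans hA'sub)
      calc ∫⁻ a in A ∩ disjointed u i, f a ∂μHE[n - 1]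
          ≤ ∫⁻ a in (A ∩ disjointed u i) ∩ N, f a ∂μHE[n - 1] +
            ∫⁻ a in A', f a ∂μHE[n - 1] := by
            conv_lhs => rw [← inter_union_sdiff (A ∩ disjointed u i) N]
            exact lintegral_union_le _ _ _
        _ = ∫⁻ a in A', f a ∂μHE[n - 1] := by
            rw [setLIntegral_measure_zero _ _ h0, zero_add]
        _ ≤ κ * ∫⁻ a in A', f a ∂graphMeasure Ω (u i) e := by
            rw [← smul_eq_mul, ← lintegral_smul_measure]
            exact lintegral_mono' hle le_rfl
        _ ≤ κ * ∫⁻ a in A', n * (ENNReal.ofReal |fderiv ℝ (height Ω (u i) e) a a| *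
              coneWeight univ a) ∂graphMeasure Ω (u i) e := by
            refine mul_le_mul_right (setLIntegral_mono' hA'm fun a ha => ?_) _
            have h5 := hU.le_inner_outwardNormal hΩ (hA'sub ha) (hd a ha)
            have h6 : ⟪outwardNormal Ω a, e⟫ ≤ 1 := by
              have h7 := real_inner_le_norm (outwardNormal Ω a) e
              rw [hU.norm_eq, mul_one] at h7
              exact h7.trans (norm_outwardNormal_le a)
            have hn0 : (n : ℝ) ≠ 0 := by positivity
            rw [coneWeight_univ hn, ← ENNReal.ofReal_natCast, ← ENNReal.ofReal_mul (abs_nonneg _),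
              ← ENNReal.ofReal_mul (Nat.cast_nonneg _)]
            refine ENNReal.ofReal_le_ofReal ?_
            rw [hU.fderiv_height_eq_outwardNormal hΩ (hA'sub ha) (hd a ha), abs_div,
              abs_of_pos (hc0.trans_le h5)]
            rw [show (n : ℝ) * (|⟪outwardNormal Ω a, a⟫| / ⟪outwardNormal Ω a, e⟫ * (1 / n)) =
              |⟪outwardNormal Ω a, a⟫| / ⟪outwardNormal Ω a, e⟫ by field_simp]
            exact le_div_self (abs_nonneg _) (hc0.trans_le h5) h6
        _ = κ * (n * volume (openCone A')) := by
            rw [lintegral_const_mul' _ _ (ENNReal.natCast_ne_top n), hvol]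
    · refine ⟨∅, empty_subset _, by simp [openCone], ?_⟩
      have : A ∩ disjointed u i = ∅ := by
        refine eq_empty_of_subset_empty fun x hx => ?_
        have := disjointed_subset u i hx.2
        rwa [h] at this
      simp [this]
  choose A' hA'sub hA'm hA'le using hloc
  have hdisj : Pairwise (Function.onFun Disjoint fun i => openCone (A' i)) := by
    intro i j hij
    rw [Function.onFun, Set.disjoint_left]
    rintro x ⟨a, ha, t, ht, rfl⟩ ⟨b, hb, s, hs, hx⟩
    have hab := (hinj a (hA'sub i ha).1 b (hA'sub j hb).1 t ht s hs hx).2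
    subst hab
    exact (Set.disjoint_left.1 (disjoint_disjointed u hij)) (hA'sub i ha).2 (hA'sub j hb).2
  have h0 : μHE[n - 1] (A \ ⋃ i, u i) = 0 := by
    refine measure_mono_null (fun x hx => ?_) hΩ.euclideanHausdorffMeasure_not_existsUnique
    exact ⟨hAΩ hx.1, fun h => hx.2 (hcov ⟨hAΩ hx.1, h⟩)⟩
  calc ∫⁻ a in A, f a ∂μHE[n - 1]
      ≤ ∫⁻ a in A ∩ ⋃ i, u i, f a ∂μHE[n - 1] + ∫⁻ a in A \ ⋃ i, u i, f a ∂μHE[n - 1] := by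
        conv_lhs => rw [← inter_union_sdiff A (⋃ i, u i)]
        exact lintegral_union_le _ _ _
    _ = ∑' i, ∫⁻ a in A ∩ disjointed u i, f a ∂μHE[n - 1] := by
        rw [setLIntegral_measure_zero _ _ h0, add_zero, ← iUnion_disjointed, inter_iUnion,
          lintegral_iUnion hAm
          (pairwise_disjoint_mono (disjoint_disjointed u) fun i => inter_subset_right)]
    _ ≤ ∑' i, κ * (n * volume (openCone (A' i))) := ENNReal.tsum_le_tsum hA'le
    _ = κ * (n * volume (⋃ i, openCone (A' i))) := by
        rw [ENNReal.tsum_mul_left, ENNReal.tsum_mul_left, measure_iUnion hdisj hA'm]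
    _ ≤ κ * (n * volume (openCone A)) := by
        gcongr
        exact iUnion_subset fun i => openCone_mono ((hA'sub i).trans inter_subset_left)

end Global

/-! ### Finsler norms, polar functions and Wulff shapes -/

section Norms

variable {n : ℕ} {p : ℝ} {F : EuclideanSpace ℝ (Fin n) → ℝ}

namespace IsFinslerNorm

theorem map_zero (hF : IsFinslerNorm p F) : F 0 = 0 := by
  have := hF.homogeneous 0 0
  simpa using this

theorem map_smul_of_nonneg (hF : IsFinslerNorm p F) {t : ℝ} (ht : 0 ≤ t)
    (x : EuclideanSpace ℝ (Fin n)) : F (t • x) = t * F x := by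
  rw [hF.homogeneous, abs_of_nonneg ht]

theorem map_neg (hF : IsFinslerNorm p F) (x : EuclideanSpace ℝ (Fin n)) : F (-x) = F x := by
  have := hF.homogeneous (-1) x
  simpa using this

theorem map_pos (hF : IsFinslerNorm p F) {x : EuclideanSpace ℝ (Fin n)} (hx : x ≠ 0) :
    0 < F x := by
  obtain ⟨a, ha, h⟩ := hF.lower_bound
  exact (mul_pos ha (norm_pos_iff.2 hx)).trans_le (h x)

theorem map_add_le (hF : IsFinslerNorm p F) (x y : EuclideanSpace ℝ (Fin n)) :
    F (x + y) ≤ F x + F y := by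
  have h := hF.convexOn.2 (mem_univ ((2 : ℝ) • x)) (mem_univ ((2 : ℝ) • y))
    (show (0 : ℝ) ≤ 1 / 2 by norm_num) (show (0 : ℝ) ≤ 1 / 2 by norm_num) (by norm_num)
  rw [smul_smul, smul_smul, hF.map_smul_of_nonneg zero_le_two,
    hF.map_smul_of_nonneg zero_le_two] at h
  norm_num at h
  linarith

theorem continuous (hF : IsFinslerNorm p F) : Continuous F :=
  hF.convexOn.locallyLipschitz.continuous

theorem exists_le_mul_norm (hF : IsFinslerNorm p F) : ∃ C, 0 < C ∧ ∀ x, F x ≤ C * ‖x‖ := by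
  obtain ⟨C, hC⟩ := (isCompact_sphere (0 : EuclideanSpace ℝ (Fin n)) 1).bddAbove_image
    hF.continuous.continuousOn
  refine ⟨max C 1, by positivity, fun x => ?_⟩
  rcases eq_or_ne x 0 with rfl | hx
  · simp [hF.map_zero]
  have hx' : 0 < ‖x‖ := norm_pos_iff.2 hx
  have h1 : F (‖x‖⁻¹ • x) ≤ C := hC ⟨_, by simp [norm_smul, hx'.ne'], rfl⟩
  rw [hF.map_smul_of_nonneg (by positivity), ← div_eq_inv_mul, div_le_iff₀ hx'] at h1
  exact h1.trans (by gcongr; exact le_max_left _ _)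

theorem inner_div_le (hF : IsFinslerNorm p F) : ∃ C, 0 < C ∧
    ∀ v ξ : EuclideanSpace ℝ (Fin n), ξ ≠ 0 → ⟪ξ, v⟫ / F ξ ≤ C * ‖v‖ := by
  obtain ⟨a, ha, h⟩ := hF.lower_bound
  refine ⟨a⁻¹, inv_pos.2 ha, fun v ξ hξ => ?_⟩
  rw [div_le_iff₀ (hF.map_pos hξ)]
  have h1 := real_inner_le_norm ξ v
  have h2 : ‖ξ‖ ≤ a⁻¹ * F ξ := by
    rw [← div_eq_inv_mul, le_div_iff₀ ha]; linarith [h ξ]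
  calc ⟪ξ, v⟫ ≤ ‖ξ‖ * ‖v‖ := h1
    _ ≤ (a⁻¹ * F ξ) * ‖v‖ := by gcongr
    _ = _ := by ring

theorem bddAbove_polar (hF : IsFinslerNorm p F) (v : EuclideanSpace ℝ (Fin n)) :
    BddAbove (range fun ξ : {ξ : EuclideanSpace ℝ (Fin n) // ξ ≠ 0} =>
      ⟪(ξ : EuclideanSpace ℝ (Fin n)), v⟫ / F ξ) := by
  obtain ⟨C, -, h⟩ := hF.inner_div_le
  exact ⟨C * ‖v‖, by rintro _ ⟨ξ, rfl⟩; exact h v ξ ξ.2⟩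

theorem inner_le_mul_polar (hF : IsFinslerNorm p F) (ξ v : EuclideanSpace ℝ (Fin n)) :
    ⟪ξ, v⟫ ≤ F ξ * polar F v := by
  rcases eq_or_ne ξ 0 with rfl | hξ
  · simp [hF.map_zero]
  have h1 : ⟪ξ, v⟫ / F ξ ≤ polar F v := le_ciSup (hF.bddAbove_polar v) ⟨ξ, hξ⟩
  rw [div_le_iff₀ (hF.map_pos hξ)] at h1
  linarith

theorem abs_inner_le_mul_polar (hF : IsFinslerNorm p F) (ξ v : EuclideanSpace ℝ (Fin n)) :
    |⟪ξ, v⟫| ≤ F ξ * polar F v := by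
  refine abs_le'.2 ⟨hF.inner_le_mul_polar ξ v, ?_⟩
  rw [← inner_neg_left, ← hF.map_neg ξ]
  exact hF.inner_le_mul_polar (-ξ) v

theorem polar_zero : polar F 0 = 0 := by
  simp [polar]

theorem polar_le (hF : IsFinslerNorm p F) {v : EuclideanSpace ℝ (Fin n)} {M : ℝ} (hM : 0 ≤ M)
    (h : ∀ ξ, ⟪ξ, v⟫ ≤ F ξ * M) : polar F v ≤ M := by
  refine Real.iSup_le (fun ξ => ?_) hM
  rw [div_le_iff₀ (hF.map_pos ξ.2)]
  linarith [h ξ]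

theorem polar_pos (hF : IsFinslerNorm p F) {v : EuclideanSpace ℝ (Fin n)} (hv : v ≠ 0) :
    0 < polar F v := by
  have h1 := hF.inner_le_mul_polar v v
  have h2 : 0 < ⟪v, v⟫ := real_inner_self_pos.2 hv
  exact pos_of_mul_pos_right (h2.trans_le h1) (hF.nonneg v)

theorem polar_nonneg (hF : IsFinslerNorm p F) (v : EuclideanSpace ℝ (Fin n)) :
    0 ≤ polar F v := by
  rcases eq_or_ne v 0 with rfl | hv
  · rw [polar_zero]
  · exact (hF.polar_pos hv).le

theorem polar_smul {t : ℝ} (ht : 0 ≤ t) (v : EuclideanSpace ℝ (Fin n)) :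
    polar F (t • v) = t * polar F v := by
  rw [polar, polar, Real.mul_iSup_of_nonneg ht]
  simp only [inner_smul_right, mul_div_assoc]

theorem polar_add_le (hF : IsFinslerNorm p F) (v w : EuclideanSpace ℝ (Fin n)) :
    polar F (v + w) ≤ polar F v + polar F w := by
  refine hF.polar_le (add_nonneg (hF.polar_nonneg v) (hF.polar_nonneg w)) fun ξ => ?_
  rw [inner_add_right, mul_add]
  exact add_le_add (hF.inner_le_mul_polar ξ v) (hF.inner_le_mul_polar ξ w)

theorem exists_polar_le (hF : IsFinslerNorm p F) :
    ∃ C, 0 < C ∧ ∀ v, polar F v ≤ C * ‖v‖ := by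
  obtain ⟨C, hC, h⟩ := hF.inner_div_le
  exact ⟨C, hC, fun v => Real.iSup_le (fun ξ => h v ξ ξ.2) (by positivity)⟩

theorem exists_norm_le_polar (hF : IsFinslerNorm p F) :
    ∃ C, 0 < C ∧ ∀ v, ‖v‖ ≤ C * polar F v := by
  obtain ⟨C, hC, h⟩ := hF.exists_le_mul_norm
  refine ⟨C, hC, fun v => ?_⟩
  rcases eq_or_ne v 0 with rfl | hv
  · simp [polar_zero]
  have h1 := hF.inner_le_mul_polar v v
  rw [real_inner_self_eq_norm_sq] at h1
  have h2 : F v * polar F v ≤ (C * ‖v‖) * polar F v :=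
    mul_le_mul_of_nonneg_right (h v) (hF.polar_nonneg v)
  have h3 : 0 < ‖v‖ := norm_pos_iff.2 hv
  nlinarith

theorem continuous_polar (hF : IsFinslerNorm p F) : Continuous (polar F) := by
  obtain ⟨C, hC, h⟩ := hF.exists_polar_le
  refine (LipschitzWith.of_le_add_mul (Real.toNNReal C) fun v w => ?_).continuous
  rw [Real.coe_toNNReal _ hC.le, dist_eq_norm]
  have h1 := hF.polar_add_le w (v - w)
  rw [add_sub_cancel] at h1
  linarith [h (v - w)]

/-- `F` is the support function of the unit ball of its polar (Hahn–Banach). -/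
theorem exists_polar_le_one_inner_eq (hF : IsFinslerNorm p F) (ν : EuclideanSpace ℝ (Fin n)) :
    ∃ y, polar F y ≤ 1 ∧ ⟪ν, y⟫ = F ν := by
  rcases eq_or_ne ν 0 with rfl | hν
  · exact ⟨0, by rw [polar_zero]; exact zero_le_one, by simp [hF.map_zero]⟩
  obtain ⟨g, hg1, hg2⟩ := exists_extension_of_le_sublinear
    (LinearPMap.mkSpanSingleton (σ := RingHom.id ℝ) ν (F ν) hν) F
    (fun c hc x => hF.map_smul_of_nonneg hc.le x) hF.map_add_le (by
      rintro ⟨x, hx⟩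
      obtain ⟨t, rfl⟩ := Submodule.mem_span_singleton.1 hx
      rw [LinearPMap.mkSpanSingleton'_apply, hF.homogeneous]
      simp only [RingHom.id_apply, smul_eq_mul]
      exact mul_le_mul_of_nonneg_right (le_abs_self t) (hF.nonneg ν))
  have hgν : g ν = F ν := by
    rw [hg1 ⟨ν, Submodule.mem_span_singleton_self ν⟩]
    exact LinearPMap.mkSpanSingleton'_apply_self _ _ _ _
  refine ⟨(InnerProductSpace.toDual ℝ _).symm (LinearMap.toContinuousLinearMap g),
    hF.polar_le zero_le_one fun ξ => ?_, ?_⟩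
  · rw [real_inner_comm, InnerProductSpace.toDual_symm_apply, mul_one]
    exact hg2 ξ
  · rw [real_inner_comm, InnerProductSpace.toDual_symm_apply]
    exact hgν

end IsFinslerNorm

theorem wulffShape_zero (F : EuclideanSpace ℝ (Fin n) → ℝ) (s : ℝ) :
    wulffShape F s 0 = {x | polar F x < s} := by
  simp [wulffShape]

theorem IsFinslerNorm.isOpen_wulffShape (hF : IsFinslerNorm p F) (s : ℝ) :
    IsOpen (wulffShape F s 0) := by
  rw [wulffShape_zero]
  exact isOpen_lt hF.continuous_polar continuous_const

theorem IsFinslerNorm.isConvexDomain_wulffShape (hF : IsFinslerNorm p F) {s : ℝ} (hs : 0 < s) :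
    IsConvexDomain (wulffShape F s 0) where
  nonempty := ⟨0, by rw [wulffShape_zero]; simpa [IsFinslerNorm.polar_zero] using hs⟩
  isBounded := by
    obtain ⟨C, hC, h⟩ := hF.exists_norm_le_polar
    refine (Metric.isBounded_closedBall (x := (0 : EuclideanSpace ℝ (Fin n)))
      (r := C * s)).subset fun x hx => ?_
    rw [wulffShape_zero] at hx
    rw [mem_closedBall_zero_iff]
    exact (h x).trans (mul_le_mul_of_nonneg_left (le_of_lt hx) hC.le)
  isOpen := hF.isOpen_wulffShape s
  convex := by
    rw [wulffShape_zero]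
    intro x hx y hy a b ha hb hab
    have hx' : polar F x < s := hx
    have hy' : polar F y < s := hy
    have h1 := hF.polar_add_le (a • x) (b • y)
    rw [polar_smul ha, polar_smul hb] at h1
    refine h1.trans_lt ?_
    have h2 : a * polar F x + b * polar F y ≤ max (polar F x) (polar F y) := by
      calc _ ≤ a * max (polar F x) (polar F y) + b * max (polar F x) (polar F y) := by
            gcongr
            exacts [le_max_left _ _, le_max_right _ _]
        _ = _ := by rw [← add_mul, hab, one_mul]
    exact h2.trans_lt (max_lt hx' hy')

theorem IsFinslerNorm.polar_le_of_mem_closure (hF : IsFinslerNorm p F) {s : ℝ}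
    {x : EuclideanSpace ℝ (Fin n)} (hx : x ∈ closure (wulffShape F s 0)) : polar F x ≤ s := by
  have hc : IsClosed {x | polar F x ≤ s} := isClosed_le hF.continuous_polar continuous_const
  refine closure_minimal (fun y hy => ?_) hc hx
  rw [wulffShape_zero] at hy
  exact (show polar F y < s from hy).le

theorem IsFinslerNorm.polar_eq_of_mem_frontier (hF : IsFinslerNorm p F) {s : ℝ}
    {x : EuclideanSpace ℝ (Fin n)} (hx : x ∈ frontier (wulffShape F s 0)) : polar F x = s := by
  refine le_antisymm (hF.polar_le_of_mem_closure (frontier_subset_closure hx)) ?_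
  rw [(hF.isOpen_wulffShape s).frontier_eq, wulffShape_zero] at hx
  exact not_lt.1 hx.2

/-- `s * F` is the support function of the Wulff shape of radius `s`; hence it is at most `⟪ν, x⟫`
for every outward normal `ν` at `x`. -/
theorem IsFinslerNorm.mul_outwardNormal_wulffShape_le (hF : IsFinslerNorm p F) {s : ℝ}
    (hs : 0 < s) (x : EuclideanSpace ℝ (Fin n)) :
    s * F (outwardNormal (wulffShape F s 0) x) ≤ |⟪outwardNormal (wulffShape F s 0) x, x⟫| := by
  by_cases h : ∃! ν, IsOutwardUnitNormal (wulffShape F s 0) x ν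
  swap
  · rw [outwardNormal_of_not h, hF.map_zero]; simp
  obtain ⟨ν, hν⟩ := h.exists
  rw [outwardNormal_eq h hν]
  obtain ⟨y, hy1, hy2⟩ := hF.exists_polar_le_one_inner_eq ν
  refine le_trans ?_ (le_abs_self _)
  -- `t • y` lies in the Wulff shape for `t < s`
  refine le_of_forall_lt_imp_le_of_dense fun r hr => ?_
  rcases le_or_gt (F ν) 0 with h0 | h0
  · have h0' : F ν = 0 := le_antisymm h0 (hF.nonneg ν)
    have h1 := hν.2 0 (by rw [wulffShape_zero]; simpa [IsFinslerNorm.polar_zero] using hs)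
    rw [h0', mul_zero] at hr
    rw [zero_sub, inner_neg_right] at h1
    linarith
  · set t := max (r / F ν) 0 with ht
    have hts : t < s := max_lt (by rwa [div_lt_iff₀ h0]) hs
    have ht0 : 0 ≤ t := le_max_right _ _
    have h1 : t • y ∈ wulffShape F s 0 := by
      rw [wulffShape_zero]
      change polar F (t • y) < s
      rw [IsFinslerNorm.polar_smul ht0]
      nlinarith [hF.polar_nonneg y]
    have h2 := hν.2 _ h1
    rw [inner_sub_right, inner_smul_right, hy2] at h2
    have h3 : r ≤ t * F ν := by rw [← div_le_iff₀ h0]; exact le_max_left _ _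
    linarith

/-- The anisotropic perimeter of a part of the boundary of the Wulff shape of radius `s` is at most
`n / s` times the volume of the cone over it. -/
theorem IsFinslerNorm.lintegral_wulffShape_le (hF : IsFinslerNorm p F) (hn : 1 ≤ n) {s : ℝ}
    (hs : 0 < s) {A : Set (EuclideanSpace ℝ (Fin n))} (hA : MeasurableSet A)
    (hAW : A ⊆ frontier (wulffShape F s 0)) :
    ∫⁻ a in A, ENNReal.ofReal (s * F (outwardNormal (wulffShape F s 0) a)) ∂μHE[n - 1] ≤
      n * volume (openCone A) := by
  refine (lintegral_mono fun a => ENNReal.ofReal_le_ofReal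
    (hF.mul_outwardNormal_wulffShape_le hs a)).trans
    ((hF.isConvexDomain_wulffShape hs).lintegral_outwardNormal_le hn hA hAW ?_)
  intro a ha b hb t ht r hr h
  have h1 := congrArg (polar F) h
  rw [polar_smul ht.1.le, polar_smul hr.1.le, hF.polar_eq_of_mem_frontier (hAW ha),
    hF.polar_eq_of_mem_frontier (hAW hb)] at h1
  have h2 : t = r := mul_right_cancel₀ hs.ne' h1
  subst h2
  exact ⟨rfl, smul_right_injective _ ht.1.ne' h⟩

end Norms

/-! ### Cutting a convex domain with a Wulff shape -/

section Cut

variable {n : ℕ} {p : ℝ} {F : EuclideanSpace ℝ (Fin n) → ℝ} {Ω : Set (EuclideanSpace ℝ (Fin n))}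

theorem exists_mem_segment_frontier (hΩ : IsOpen Ω) {x y : EuclideanSpace ℝ (Fin n)} (hx : x ∈ Ω)
    (hy : y ∉ Ω) : ∃ z ∈ segment ℝ x y, z ∈ frontier Ω := by
  by_contra! hcon
  have h1 : segment ℝ x y ⊆ Ω ∪ (closure Ω)ᶜ := by
    intro z hz
    by_cases h : z ∈ closure Ω
    · by_cases h' : z ∈ Ω
      · exact Or.inl h'
      · exact absurd (by rw [hΩ.frontier_eq]; exact ⟨h, h'⟩) (hcon z hz)
    · exact Or.inr h
  have h2 := (convex_segment x y).isPreconnected.subset_left_of_subset_union hΩ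
    isClosed_closure.isOpen_compl
    (disjoint_compl_right.mono_left subset_closure) h1 ⟨x, left_mem_segment ℝ x y, hx⟩
  exact hy (h2 (right_mem_segment ℝ x y))

/-- The ray from `0` through a point `x ≠ 0` of a bounded open set leaves the set beyond `x`. -/
theorem IsConvexDomain.exists_smul_mem_frontier (hΩ : IsConvexDomain Ω)
    {x : EuclideanSpace ℝ (Fin n)} (hx : x ∈ Ω) (hx0 : x ≠ 0) :
    ∃ τ : ℝ, 1 < τ ∧ τ • x ∈ frontier Ω := by
  obtain ⟨R, hR⟩ := hΩ.isBounded.exists_norm_le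
  have hxn : 0 < ‖x‖ := norm_pos_iff.2 hx0
  have hR0 : 0 ≤ R := (norm_nonneg x).trans (hR x hx)
  have hy : (R / ‖x‖ + 1) • x ∉ Ω := by
    intro h
    have h1 := hR _ h
    rw [norm_smul, Real.norm_of_nonneg (by positivity), add_mul, div_mul_cancel₀ _ hxn.ne'] at h1
    linarith
  obtain ⟨z, ⟨a, b, ha, hb, hab, rfl⟩, hz⟩ := exists_mem_segment_frontier hΩ.isOpen hx hy
  have h2 : a • x + b • ((R / ‖x‖ + 1) • x) = (1 + b * (R / ‖x‖)) • x := by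
    rw [smul_smul, ← add_smul]
    congr 1
    rw [show a = 1 - b by linarith]; ring
  rw [h2] at hz
  refine ⟨_, ?_, hz⟩
  have h3 : 0 ≤ b * (R / ‖x‖) := by positivity
  refine lt_of_le_of_ne (by linarith) fun h => ?_
  rw [← h, one_smul, hΩ.isOpen.frontier_eq] at hz
  exact hz.2 hx

theorem coneWeight_wulffShape (hn : 1 ≤ n) {s : ℝ} (hs : 0 < s)
    {a : EuclideanSpace ℝ (Fin n)} (ha : s < polar F a) :
    coneWeight {x | polar F x < s} a = ENNReal.ofReal ((s / polar F a) ^ n / n) := by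
  have hb : 0 < polar F a := hs.trans ha
  have h1 : {t : ℝ | t ∈ Ioo (0 : ℝ) 1 ∧ t • a ∈ {x | polar F x < s}} =
      Ioo 0 (s / polar F a) := by
    ext t
    simp only [mem_ofPred_eq, mem_Ioo]
    constructor
    · rintro ⟨ht, h⟩
      rw [IsFinslerNorm.polar_smul ht.1.le] at h
      exact ⟨ht.1, by rwa [lt_div_iff₀ hb]⟩
    · rintro ⟨h0, h⟩
      refine ⟨⟨h0, h.trans ((div_lt_one hb).2 ha)⟩, ?_⟩
      rwa [IsFinslerNorm.polar_smul h0.le, ← lt_div_iff₀ hb]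
  rw [coneWeight, h1, lintegral_Ioo_pow hn le_rfl (by positivity), zero_pow (by omega), sub_zero]

theorem coneWeight_compl_wulffShape (hn : 1 ≤ n) {s : ℝ} (hs : 0 < s)
    {a : EuclideanSpace ℝ (Fin n)} (ha : s < polar F a) :
    coneWeight {x | s ≤ polar F x} a = ENNReal.ofReal ((1 - (s / polar F a) ^ n) / n) := by
  have hb : 0 < polar F a := hs.trans ha
  have h1 : {t : ℝ | t ∈ Ioo (0 : ℝ) 1 ∧ t • a ∈ {x | s ≤ polar F x}} =
      Ico (s / polar F a) 1 := by
    ext t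
    simp only [mem_ofPred_eq, mem_Ioo, mem_Ico]
    constructor
    · rintro ⟨ht, h⟩
      rw [IsFinslerNorm.polar_smul ht.1.le] at h
      exact ⟨by rwa [div_le_iff₀ hb], ht.2⟩
    · rintro ⟨h, ht⟩
      have h0 : 0 < t := (div_pos hs hb).trans_le h
      refine ⟨⟨h0, ht⟩, ?_⟩
      rwa [IsFinslerNorm.polar_smul h0.le, ← div_le_iff₀ hb]
  rw [coneWeight, h1, restrict_Ico_eq_restrict_Ioc, ← restrict_Ioo_eq_restrict_Ioc,
    lintegral_Ioo_pow hn (by positivity) ((div_le_one hb).2 ha.le), one_pow]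

/-- **Flux inequality.** The part of the boundary of `Ω` outside the Wulff shape of radius `s`,
weighted by `g (F°)`, dominates the part of the boundary of the Wulff shape inside `Ω` together with
`κ` times the volume cut off, if the divergence of the radial field `g (F°) x / F°` is at least `κ`;
the hypothesis `hg` is this bound, integrated along a ray. -/
theorem IsFinslerNorm.flux_le (hF : IsFinslerNorm p F) (hn : 1 ≤ n) (hΩ : IsConvexDomain Ω)
    {s κ : ℝ} (hs : 0 < s) (hκ : 0 ≤ κ) {g : ℝ → ℝ} (hgs : 0 ≤ g s)
    (hg : ∀ x ∈ frontier Ω, s < polar F x →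
      s ^ (n - 1) * g s + κ * ((polar F x ^ n - s ^ n) / n) ≤ polar F x ^ (n - 1) * g (polar F x)) :
    ENNReal.ofReal (g s) * ∫⁻ a in frontier (wulffShape F s 0) ∩ Ω,
        ENNReal.ofReal (F (outwardNormal (wulffShape F s 0) a)) ∂μHE[n - 1] +
      ENNReal.ofReal κ * volume (Ω ∩ {x | s ≤ polar F x}) ≤
    ∫⁻ a in frontier Ω ∩ {x | s < polar F x},
      ENNReal.ofReal (g (polar F a) * F (outwardNormal Ω a)) ∂μHE[n - 1] := by
  set A := frontier Ω ∩ {x | s < polar F x} with hA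
  set Z₁ : Set (EuclideanSpace ℝ (Fin n)) := {x | polar F x < s} with hZ₁
  set Z₂ : Set (EuclideanSpace ℝ (Fin n)) := {x | s ≤ polar F x} with hZ₂
  set B := frontier (wulffShape F s 0) ∩ Ω with hB
  have hpm := hF.continuous_polar.measurable
  have hAm : MeasurableSet A :=
    isClosed_frontier.measurableSet.inter (measurableSet_lt measurable_const hpm)
  have hZ₁m : MeasurableSet Z₁ := measurableSet_lt hpm measurable_const
  have hZ₂m : MeasurableSet Z₂ := measurableSet_le measurable_const hpm
  have hBm : MeasurableSet B := isClosed_frontier.measurableSet.inter hΩ.isOpen.measurableSet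
  have hn0 : (0 : ℝ) < n := by exact_mod_cast hn
  -- rays through points of `Ω` outside the open Wulff shape end in `A`
  have hexit : ∀ x ∈ Ω, s ≤ polar F x → ∃ τ : ℝ, 1 < τ ∧ τ • x ∈ A := by
    intro x hx hsx
    have hx0 : x ≠ 0 := by
      rintro rfl
      rw [IsFinslerNorm.polar_zero] at hsx
      linarith
    obtain ⟨τ, hτ, hmem⟩ := hΩ.exists_smul_mem_frontier hx hx0
    refine ⟨τ, hτ, hmem, ?_⟩
    change s < polar F (τ • x)
    rw [IsFinslerNorm.polar_smul (by linarith)]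
    nlinarith
  -- inside the Wulff shape the cone over `A` contains the cone over `B`
  have hsub₁ : openCone B ⊆ openCone A ∩ Z₁ := by
    rintro _ ⟨b, hb, t, ht, rfl⟩
    have hbs := hF.polar_eq_of_mem_frontier hb.1
    obtain ⟨τ, hτ, hmem⟩ := hexit b hb.2 hbs.ge
    refine ⟨⟨_, hmem, t / τ, ⟨by have := ht.1; positivity, ?_⟩, ?_⟩, ?_⟩
    · rw [div_lt_one (by linarith)]; linarith [ht.2]
    · rw [smul_smul, div_mul_cancel₀ _ (by linarith)]
    · change polar F (t • b) < s
      rw [IsFinslerNorm.polar_smul ht.1.le, hbs]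
      nlinarith [ht.2]
  have hsub₂ : Ω ∩ Z₂ ⊆ openCone A ∩ Z₂ := by
    rintro x ⟨hx, hsx⟩
    obtain ⟨τ, hτ, hmem⟩ := hexit x hx hsx
    refine ⟨⟨_, hmem, τ⁻¹, ⟨by positivity, inv_lt_one_of_one_lt₀ hτ⟩, ?_⟩, hsx⟩
    rw [smul_smul, inv_mul_cancel₀ (by linarith), one_smul]
  let f : EuclideanSpace ℝ (Fin n) → ENNReal := fun a => ENNReal.ofReal |⟪outwardNormal Ω a, a⟫|
  have h₁ : ENNReal.ofReal (g s) * ∫⁻ a in B,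
      ENNReal.ofReal (F (outwardNormal (wulffShape F s 0) a)) ∂μHE[n - 1] ≤
      ∫⁻ a in A, ENNReal.ofReal (n * (g s / s)) * (f a * coneWeight Z₁ a) ∂μHE[n - 1] := by
    rw [lintegral_const_mul' _ _ ENNReal.ofReal_ne_top]
    have h := (hF.lintegral_wulffShape_le hn hs hBm inter_subset_left).trans
      (mul_le_mul_right ((measure_mono hsub₁).trans
        (hΩ.volume_openCone_inter_le hn hAm hZ₁m inter_subset_left)) _)
    calc _ = ENNReal.ofReal (g s / s) * ∫⁻ a in B,
          ENNReal.ofReal (s * F (outwardNormal (wulffShape F s 0) a)) ∂μHE[n - 1] := by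
          simp only [ENNReal.ofReal_mul hs.le]
          rw [lintegral_const_mul' _ _ ENNReal.ofReal_ne_top, ← mul_assoc,
            ← ENNReal.ofReal_mul (by positivity), div_mul_cancel₀ _ hs.ne']
      _ ≤ ENNReal.ofReal (g s / s) * (n * ∫⁻ a in A, f a * coneWeight Z₁ a ∂μHE[n - 1]) :=
          mul_le_mul_right h _
      _ = _ := by
          rw [ENNReal.ofReal_mul hn0.le, ENNReal.ofReal_natCast]; ring
  have h₂ : ENNReal.ofReal κ * volume (Ω ∩ Z₂) ≤
      ∫⁻ a in A, ENNReal.ofReal κ * (f a * coneWeight Z₂ a) ∂μHE[n - 1] := by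
    rw [lintegral_const_mul' _ _ ENNReal.ofReal_ne_top]
    exact mul_le_mul_right ((measure_mono hsub₂).trans
        (hΩ.volume_openCone_inter_le hn hAm hZ₂m inter_subset_left)) _
  -- both terms are now integrals over `A`, and it is enough to compare the integrands
  refine (add_le_add h₁ h₂).trans ((le_lintegral_add _ _).trans ?_)
  refine setLIntegral_mono' hAm fun a ha => ?_
  have hsa : s < polar F a := ha.2
  have hb : 0 < polar F a := hs.trans hsa
  have hgb := hg a ha.1 hsa
  set b := polar F a with hbdef
  have hsb : (s / b) ^ n ≤ 1 := pow_le_one₀ (by positivity) ((div_le_one hb).2 hsa.le)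
  rw [coneWeight_wulffShape hn hs hsa, coneWeight_compl_wulffShape hn hs hsa, ← hbdef]
  simp only [f]
  rw [← ENNReal.ofReal_mul (abs_nonneg _), ← ENNReal.ofReal_mul (abs_nonneg _),
    ← ENNReal.ofReal_mul (by positivity), ← ENNReal.ofReal_mul hκ,
    ← ENNReal.ofReal_add (by positivity)
      (mul_nonneg hκ (mul_nonneg (abs_nonneg _) (div_nonneg (by linarith) hn0.le)))]
  refine ENNReal.ofReal_le_ofReal ?_
  have hin := hF.abs_inner_le_mul_polar (outwardNormal Ω a) a
  rw [← hbdef] at hin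
  obtain ⟨m, rfl⟩ : ∃ m, n = m + 1 := ⟨n - 1, by omega⟩
  rw [Nat.add_sub_cancel] at hgb
  have hbm : 0 < b ^ (m + 1) := pow_pos hb _
  have hfac : (↑(m + 1) * (g s / s)) * (|⟪outwardNormal Ω a, a⟫| * ((s / b) ^ (m + 1) / ↑(m + 1))) +
      κ * (|⟪outwardNormal Ω a, a⟫| * ((1 - (s / b) ^ (m + 1)) / ↑(m + 1))) =
      |⟪outwardNormal Ω a, a⟫| * ((s ^ m * g s + κ * ((b ^ (m + 1) - s ^ (m + 1)) / ↑(m + 1))) /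
        b ^ (m + 1)) := by
    rw [div_pow]
    field_simp
    ring
  rw [hfac]
  have hq0 : 0 ≤ (s ^ m * g s + κ * ((b ^ (m + 1) - s ^ (m + 1)) / ↑(m + 1))) / b ^ (m + 1) := by
    refine div_nonneg (add_nonneg (by positivity) (mul_nonneg hκ (div_nonneg ?_ hn0.le))) hbm.le
    exact sub_nonneg.2 (pow_le_pow_left₀ hs.le hsa.le _)
  calc _ ≤ (F (outwardNormal Ω a) * b) * ((b ^ m * g b) / b ^ (m + 1)) := by
        refine mul_le_mul hin ?_ hq0 (mul_nonneg (hF.nonneg _) hb.le)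
        gcongr
    _ = g b * F (outwardNormal Ω a) := by
        field_simp
        ring

end Cut

/-! ### Weighted perimeters -/

section Weighted

variable {n : ℕ} {p : ℝ} {F : EuclideanSpace ℝ (Fin n) → ℝ} {Ω : Set (EuclideanSpace ℝ (Fin n))}

/-- The anisotropic perimeter with weight `w (F°)`. -/
noncomputable def weightedPerimeter (F : EuclideanSpace ℝ (Fin n) → ℝ) (w : ℝ → ℝ)
    (Ω : Set (EuclideanSpace ℝ (Fin n))) : ℝ :=
  ∫ x in frontier Ω, w (polar F x) * F (outwardNormal Ω x) ∂(μHE[n - 1])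

theorem anisotropicPerimeter_eq : anisotropicPerimeter F Ω = weightedPerimeter F (fun _ => 1) Ω :=
    by
  simp [anisotropicPerimeter, weightedPerimeter]

theorem boundaryMomentum_eq :
    boundaryMomentum p F Ω = weightedPerimeter F (fun t => t ^ p) Ω := rfl

theorem IsFinslerNorm.integrableOn_weight (hF : IsFinslerNorm p F) (hΩ : IsConvexDomain Ω)
    {w : ℝ → ℝ} (hw : Continuous w) :
    IntegrableOn (fun x => w (polar F x) * F (outwardNormal Ω x)) (frontier Ω) (μHE[n - 1]) := by
  have hcpt : IsCompact (frontier Ω) :=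
    Metric.isCompact_of_isClosed_isBounded isClosed_frontier
      (hΩ.isBounded.closure.subset frontier_subset_closure)
  obtain ⟨C, hC0, hC⟩ := hF.exists_le_mul_norm
  obtain ⟨M, hM⟩ := hcpt.exists_bound_of_continuousOn
    (hw.comp hF.continuous_polar).continuousOn
  have : IsFiniteMeasure ((μHE[n - 1] : Measure (EuclideanSpace ℝ (Fin n))).restrict
      (frontier Ω)) := ⟨by simpa using hΩ.euclideanHausdorffMeasure_frontier_lt_top⟩
  refine Integrable.of_bound (C := M * C) ?_ ?_
  · exact ((hw.comp hF.continuous_polar).measurable.aemeasurable.mul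
      (hF.continuous.measurable.comp_aemeasurable
        hΩ.aemeasurable_outwardNormal)).aestronglyMeasurable
  · rw [ae_restrict_iff' isClosed_frontier.measurableSet]
    refine Filter.Eventually.of_forall fun x hx => ?_
    rw [norm_mul, Real.norm_of_nonneg (hF.nonneg _)]
    have h1 : F (outwardNormal Ω x) ≤ C := (hC _).trans (by
      have := norm_outwardNormal_le (Ω := Ω) x
      nlinarith)
    have h2 := hM x hx
    exact mul_le_mul h2 h1 (hF.nonneg _) ((norm_nonneg _).trans h2)

/-- At a common boundary point a normal of the larger set is a normal of the subset. So the two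
outward normals agree where the subset has only one normal; elsewhere the left-hand side is `F 0 =
0`. -/
theorem IsFinslerNorm.apply_outwardNormal_le_of_subset (hF : IsFinslerNorm p F)
    (hΩ : IsConvexDomain Ω) {K : Set (EuclideanSpace ℝ (Fin n))} (hK : K ⊆ Ω)
    {x : EuclideanSpace ℝ (Fin n)} (hx : x ∈ frontier Ω) :
    F (outwardNormal K x) ≤ F (outwardNormal Ω x) := by
  by_cases h : ∃! ν, IsOutwardUnitNormal K x ν
  · obtain ⟨ν, hν⟩ := hΩ.exists_normal hx
    have hu : ∃! ν, IsOutwardUnitNormal Ω x ν :=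
      ⟨ν, hν, fun ν' hν' => h.unique (hν'.mono hK) (hν.mono hK)⟩
    rw [outwardNormal_eq h (hν.mono hK), outwardNormal_eq hu hν]
  · rw [outwardNormal_of_not h, hF.map_zero]
    exact hF.nonneg _

/-- The normal of a convex domain at a boundary point is determined by the domain near that point.
-/
theorem IsConvexDomain.outwardNormal_inter_of_isOpen (hΩ : IsConvexDomain Ω)
    {W : Set (EuclideanSpace ℝ (Fin n))} (hW : IsOpen W) {x : EuclideanSpace ℝ (Fin n)}
    (hx : x ∈ frontier Ω) (hxW : x ∈ W) : outwardNormal (Ω ∩ W) x = outwardNormal Ω x := by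
  have key : ∀ ν, IsOutwardUnitNormal (Ω ∩ W) x ν ↔ IsOutwardUnitNormal Ω x ν := by
    refine fun ν => ⟨fun h => ⟨h.1, fun y hy => ?_⟩, fun h => h.mono inter_subset_left⟩
    have hcont : Continuous fun t : ℝ => x + t • (y - x) := by fun_prop
    have h0 : ∀ᶠ t in nhds (0 : ℝ), x + t • (y - x) ∈ W :=
      hcont.continuousAt.eventually_mem (hW.mem_nhds (by simpa using hxW))
    obtain ⟨t, ht, ht0, ht1⟩ := ((h0.filter_mono nhdsWithin_le_nhds).and
      (Ioo_mem_nhdsGT (show (0 : ℝ) < 1 by norm_num))).exists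
    have hmem : x + t • (y - x) ∈ Ω := by
      have := hΩ.convex.combo_closure_interior_mem_interior (frontier_subset_closure hx)
        (hΩ.isOpen.interior_eq.symm ▸ hy) (show 0 ≤ 1 - t by linarith) ht0 (by ring)
      rw [hΩ.isOpen.interior_eq] at this
      rwa [show x + t • (y - x) = (1 - t) • x + t • y by module]
    have h1 := h.2 _ ⟨hmem, ht⟩
    rw [add_sub_cancel_left, inner_smul_right] at h1
    exact nonpos_of_mul_nonpos_right h1 ht0
  by_cases h : ∃! ν, IsOutwardUnitNormal Ω x ν
  · obtain ⟨ν, hν⟩ := h.exists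
    have h' : ∃! ν, IsOutwardUnitNormal (Ω ∩ W) x ν := by simpa only [key] using h
    rw [outwardNormal_eq h hν, outwardNormal_eq h' ((key ν).2 hν)]
  · have h' : ¬ ∃! ν, IsOutwardUnitNormal (Ω ∩ W) x ν := by simpa only [key] using h
    rw [outwardNormal_of_not h, outwardNormal_of_not h']

theorem IsFinslerNorm.isConvexDomain_inter_wulffShape (hF : IsFinslerNorm p F)
    (hΩ : IsConvexDomain Ω) {s : ℝ} (hs : 0 < s) (hne : (Ω ∩ wulffShape F s 0).Nonempty) :
    IsConvexDomain (Ω ∩ wulffShape F s 0) where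
  nonempty := hne
  isBounded := hΩ.isBounded.subset inter_subset_left
  isOpen := hΩ.isOpen.inter (hF.isOpen_wulffShape s)
  convex := hΩ.convex.inter (hF.isConvexDomain_wulffShape hs).convex

/-- Cutting `Ω` with the Wulff shape of radius `s` lowers the weighted perimeter by at least `κ`
times the volume cut off, for weights as in the flux inequality. -/
theorem IsFinslerNorm.weightedPerimeter_inter_wulffShape_le (hF : IsFinslerNorm p F) (hn : 1 ≤ n)
    (hΩ : IsConvexDomain Ω) {s κ : ℝ} (hs : 0 < s) (hne : (Ω ∩ wulffShape F s 0).Nonempty)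
    (hκ : 0 ≤ κ) {w : ℝ → ℝ} (hwc : Continuous w) (hws : 0 ≤ w s)
    (hw : ∀ x ∈ frontier Ω, s < polar F x →
      s ^ (n - 1) * w s + κ * ((polar F x ^ n - s ^ n) / n) ≤ polar F x ^ (n - 1) * w (polar F x)) :
    weightedPerimeter F w (Ω ∩ wulffShape F s 0) ≤
      weightedPerimeter F w Ω - κ * vol (Ω ∩ {x | s ≤ polar F x}) := by
  set W := wulffShape F s 0 with hWdef
  set K := Ω ∩ W with hKdef
  have hWmem : ∀ x, x ∈ W ↔ polar F x < s := fun x => by rw [hWdef, wulffShape_zero]; rfl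
  have hWd : IsConvexDomain W := hF.isConvexDomain_wulffShape hs
  have hK : IsConvexDomain K := hF.isConvexDomain_inter_wulffShape hΩ hs hne
  have hWm : MeasurableSet W := hWd.isOpen.measurableSet
  have hΩm : MeasurableSet Ω := hΩ.isOpen.measurableSet
  have hfm : ∀ S : Set (EuclideanSpace ℝ (Fin n)), MeasurableSet (frontier S) :=
    fun S => isClosed_frontier.measurableSet
  have hpm := hF.continuous_polar.measurable
  let f : Set (EuclideanSpace ℝ (Fin n)) → EuclideanSpace ℝ (Fin n) → ℝ :=
    fun S x => w (polar F x) * F (outwardNormal S x)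
  have hfK : IntegrableOn (f K) (frontier K) μHE[n - 1] := hF.integrableOn_weight hK hwc
  have hfΩ : IntegrableOn (f Ω) (frontier Ω) μHE[n - 1] := hF.integrableOn_weight hΩ hwc
  have hfW : IntegrableOn (f W) (frontier W) μHE[n - 1] := hF.integrableOn_weight hWd hwc
  -- the boundary of the cut domain inside the Wulff shape is that of `Ω`
  have hKW : frontier K ∩ W = frontier Ω ∩ W := by
    rw [hKdef, frontier_inter_open_inter hWd.isOpen]
  have hin : ∫ x in frontier K ∩ W, f K x ∂μHE[n - 1] =
      ∫ x in frontier Ω ∩ W, f Ω x ∂μHE[n - 1] := by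
    rw [hKW]
    refine setIntegral_congr_fun ((hfm Ω).inter hWm) fun x hx => ?_
    simp only [f]
    rw [hKdef, hΩ.outwardNormal_inter_of_isOpen hWd.isOpen hx.1 hx.2]
  -- elsewhere it consists of points at level `s`
  have hlevel : ∀ x ∈ frontier K \ W, polar F x = s := by
    intro x hx
    refine le_antisymm (hF.polar_le_of_mem_closure
      (closure_mono inter_subset_right (frontier_subset_closure hx.1))) ?_
    exact not_lt.1 fun h => hx.2 ((hWmem x).2 h)
  have hsub₁ : (frontier K \ W) ∩ Ω ⊆ frontier W ∩ Ω := by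
    rintro x ⟨hx, hxΩ⟩
    refine ⟨?_, hxΩ⟩
    rw [hWd.isOpen.frontier_eq]
    exact ⟨closure_mono inter_subset_right (frontier_subset_closure hx.1), hx.2⟩
  have hsub₂ : (frontier K \ W) \ Ω ⊆ frontier Ω ∩ {x | polar F x = s} := by
    rintro x ⟨hx, hxΩ⟩
    refine ⟨?_, hlevel x hx⟩
    rw [hΩ.isOpen.frontier_eq]
    exact ⟨closure_mono inter_subset_left (frontier_subset_closure hx.1), hxΩ⟩
  have hsm : MeasurableSet {x | polar F x = s} := measurableSet_eq_fun hpm measurable_const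
  have h₁ : ∫ x in (frontier K \ W) ∩ Ω, f K x ∂μHE[n - 1] ≤
      ∫ x in frontier W ∩ Ω, f W x ∂μHE[n - 1] := by
    have hm := ((hfm K).diff hWm).inter hΩm
    calc ∫ x in (frontier K \ W) ∩ Ω, f K x ∂μHE[n - 1]
        ≤ ∫ x in (frontier K \ W) ∩ Ω, f W x ∂μHE[n - 1] := by
          refine setIntegral_mono_on (hfK.mono_set (inter_subset_left.trans sdiff_subset))
            (hfW.mono_set (hsub₁.trans inter_subset_left)) hm fun x hx => ?_
          simp only [f]
          rw [hlevel x hx.1]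
          exact mul_le_mul_of_nonneg_left
            (hF.apply_outwardNormal_le_of_subset hWd inter_subset_right (hsub₁ hx).1) hws
      _ ≤ ∫ x in frontier W ∩ Ω, f W x ∂μHE[n - 1] := by
          refine setIntegral_mono_set (hfW.mono_set inter_subset_left) ?_
            (Filter.Eventually.of_forall hsub₁)
          rw [Filter.EventuallyLE, ae_restrict_iff' ((hfm W).inter hΩm)]
          refine Filter.Eventually.of_forall fun x hx => ?_
          simp only [f, Pi.zero_apply]
          rw [hF.polar_eq_of_mem_frontier hx.1]
          exact mul_nonneg hws (hF.nonneg _)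
  have h₂ : ∫ x in (frontier K \ W) \ Ω, f K x ∂μHE[n - 1] ≤
      ∫ x in frontier Ω ∩ {x | polar F x = s}, f Ω x ∂μHE[n - 1] := by
    have hm := ((hfm K).diff hWm).diff hΩm
    calc ∫ x in (frontier K \ W) \ Ω, f K x ∂μHE[n - 1]
        ≤ ∫ x in (frontier K \ W) \ Ω, f Ω x ∂μHE[n - 1] := by
          refine setIntegral_mono_on (hfK.mono_set (sdiff_subset.trans sdiff_subset))
            (hfΩ.mono_set (hsub₂.trans inter_subset_left)) hm fun x hx => ?_
          simp only [f]
          rw [hlevel x hx.1]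
          exact mul_le_mul_of_nonneg_left
            (hF.apply_outwardNormal_le_of_subset hΩ inter_subset_left (hsub₂ hx).1) hws
      _ ≤ ∫ x in frontier Ω ∩ {x | polar F x = s}, f Ω x ∂μHE[n - 1] := by
          refine setIntegral_mono_set (hfΩ.mono_set inter_subset_left) ?_
            (Filter.Eventually.of_forall hsub₂)
          rw [Filter.EventuallyLE, ae_restrict_iff' ((hfm Ω).inter hsm)]
          refine Filter.Eventually.of_forall fun x hx => ?_
          simp only [f, Pi.zero_apply]
          rw [show polar F x = s from hx.2]
          exact mul_nonneg hws (hF.nonneg _)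
  -- the flux inequality, for real integrals
  have hflux : ∫ x in frontier W ∩ Ω, f W x ∂μHE[n - 1] + κ * vol (Ω ∩ {x | s ≤ polar F x}) ≤
      ∫ x in frontier Ω ∩ {x | s < polar F x}, f Ω x ∂μHE[n - 1] := by
    have hcm : MeasurableSet {x | s < polar F x} := measurableSet_lt measurable_const hpm
    have hnn : ∀ x ∈ frontier Ω, s < polar F x → 0 ≤ w (polar F x) := by
      intro x hx hsx
      have h := hw x hx hsx
      have hb : 0 < polar F x := hs.trans hsx
      have h3 : 0 ≤ polar F x ^ n - s ^ n := sub_nonneg.2 (pow_le_pow_left₀ hs.le hsx.le _)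
      have h4 : 0 ≤ polar F x ^ (n - 1) * w (polar F x) := le_trans (by positivity) h
      exact nonneg_of_mul_nonneg_right h4 (by positivity)
    have h := hF.flux_le hn hΩ hs hκ hws hw
    have hL : ENNReal.ofReal (∫ x in frontier W ∩ Ω, f W x ∂μHE[n - 1]) =
        ENNReal.ofReal (w s) * ∫⁻ a in frontier W ∩ Ω,
          ENNReal.ofReal (F (outwardNormal W a)) ∂μHE[n - 1] := by
      rw [ofReal_integral_eq_lintegral_ofReal (hfW.mono_set inter_subset_left)]
      · rw [← lintegral_const_mul' _ _ ENNReal.ofReal_ne_top]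
        refine setLIntegral_congr_fun ((hfm W).inter hΩm) fun x hx => ?_
        simp only [f]
        rw [hF.polar_eq_of_mem_frontier hx.1, ENNReal.ofReal_mul hws]
      · rw [Filter.EventuallyLE, ae_restrict_iff' ((hfm W).inter hΩm)]
        refine Filter.Eventually.of_forall fun x hx => ?_
        simp only [f, Pi.zero_apply]
        rw [hF.polar_eq_of_mem_frontier hx.1]
        exact mul_nonneg hws (hF.nonneg _)
    have hR : ENNReal.ofReal (∫ x in frontier Ω ∩ {x | s < polar F x}, f Ω x ∂μHE[n - 1]) =
        ∫⁻ a in frontier Ω ∩ {x | s < polar F x},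
          ENNReal.ofReal (w (polar F a) * F (outwardNormal Ω a)) ∂μHE[n - 1] := by
      rw [ofReal_integral_eq_lintegral_ofReal (hfΩ.mono_set inter_subset_left)]
      rw [Filter.EventuallyLE, ae_restrict_iff' ((hfm Ω).inter hcm)]
      exact Filter.Eventually.of_forall fun x hx =>
        mul_nonneg (hnn x hx.1 hx.2) (hF.nonneg _)
    have hV : ENNReal.ofReal (vol (Ω ∩ {x | s ≤ polar F x})) =
        volume (Ω ∩ {x | s ≤ polar F x}) :=
      ENNReal.ofReal_toReal (hΩ.isBounded.subset inter_subset_left).measure_lt_top.ne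
    have hW0 : 0 ≤ ∫ x in frontier W ∩ Ω, f W x ∂μHE[n - 1] := by
      refine setIntegral_nonneg ((hfm W).inter hΩm) fun x hx => ?_
      simp only [f]
      rw [hF.polar_eq_of_mem_frontier hx.1]
      exact mul_nonneg hws (hF.nonneg _)
    have hΩ0 : 0 ≤ ∫ x in frontier Ω ∩ {x | s < polar F x}, f Ω x ∂μHE[n - 1] :=
      setIntegral_nonneg ((hfm Ω).inter hcm) fun x hx =>
        mul_nonneg (hnn x hx.1 hx.2) (hF.nonneg _)
    rw [← hL, ← hR, ← hV, ← ENNReal.ofReal_mul hκ,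
      ← ENNReal.ofReal_add hW0
        (mul_nonneg hκ (show 0 ≤ vol _ from ENNReal.toReal_nonneg))] at h
    exact (ENNReal.ofReal_le_ofReal_iff hΩ0).1 h
  have hsplitK : weightedPerimeter F w K = ∫ x in frontier K ∩ W, f K x ∂μHE[n - 1] +
      (∫ x in (frontier K \ W) ∩ Ω, f K x ∂μHE[n - 1] +
        ∫ x in (frontier K \ W) \ Ω, f K x ∂μHE[n - 1]) := by
    rw [integral_inter_add_sdiff hΩm (hfK.mono_set sdiff_subset),
      integral_inter_add_sdiff hWm hfK]
    rfl
  have hsplitΩ : weightedPerimeter F w Ω = ∫ x in frontier Ω ∩ W, f Ω x ∂μHE[n - 1] +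
      (∫ x in frontier Ω ∩ {x | polar F x = s}, f Ω x ∂μHE[n - 1] +
        ∫ x in frontier Ω ∩ {x | s < polar F x}, f Ω x ∂μHE[n - 1]) := by
    have e1 : frontier Ω ∩ {x | polar F x = s} = (frontier Ω \ W) ∩ {x | polar F x = s} := by
      ext x
      simp only [mem_inter_iff, mem_sdiff, hWmem, mem_ofPred_eq]
      constructor
      · rintro ⟨h1, h2⟩; exact ⟨⟨h1, h2.ge.not_gt⟩, h2⟩
      · rintro ⟨⟨h1, -⟩, h2⟩; exact ⟨h1, h2⟩
    have e2 : frontier Ω ∩ {x | s < polar F x} = (frontier Ω \ W) \ {x | polar F x = s} := by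
      ext x
      simp only [mem_inter_iff, mem_sdiff, hWmem, mem_ofPred_eq]
      constructor
      · rintro ⟨h1, h2⟩; exact ⟨⟨h1, h2.le.not_gt⟩, h2.ne'⟩
      · rintro ⟨⟨h1, h2⟩, h3⟩; exact ⟨h1, lt_of_le_of_ne (not_lt.1 h2) (Ne.symm h3)⟩
    rw [e1, e2, integral_inter_add_sdiff hsm (hfΩ.mono_set sdiff_subset),
      integral_inter_add_sdiff hWm hfΩ]
    rfl
  rw [hsplitK, hsplitΩ, hin]
  linarith

end Weighted

/-! ### Positivity of weighted perimeters -/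

section Positivity

variable {n : ℕ} {p : ℝ} {F : EuclideanSpace ℝ (Fin n) → ℝ} {Ω : Set (EuclideanSpace ℝ (Fin n))}

/-- Every part of the boundary of a convex domain has positive surface measure: its projection along
a segment that starts in the domain contains a ball. -/
theorem IsConvexDomain.euclideanHausdorffMeasure_inter_frontier_pos (hΩ : IsConvexDomain Ω)
    {U : Set (EuclideanSpace ℝ (Fin n))} (hU : IsOpen U) {x₀ : EuclideanSpace ℝ (Fin n)}
    (hx₀ : x₀ ∈ frontier Ω) (hxU : x₀ ∈ U) : 0 < μHE[n - 1] (U ∩ frontier Ω) := by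
  obtain ⟨z, hz⟩ := hΩ.nonempty
  obtain ⟨r, hr, hball⟩ := Metric.isOpen_iff.1 hU x₀ hxU
  have hx₀' : x₀ ∉ Ω := by
    rw [hΩ.isOpen.frontier_eq] at hx₀; exact hx₀.2
  have hne : x₀ - z ≠ 0 := fun h => hx₀' (by rwa [sub_eq_zero.1 h])
  have hpos : 0 < ‖x₀ - z‖ := norm_pos_iff.2 hne
  set e := ‖x₀ - z‖⁻¹ • (x₀ - z) with he
  have henorm : ‖e‖ = 1 := norm_smul_inv_norm hne
  obtain ⟨θ, hθ0, hθ1, hθr⟩ : ∃ θ : ℝ, 0 < θ ∧ θ < 1 ∧ θ * ‖x₀ - z‖ < r / 2 := by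
    refine ⟨min (1 / 2) (r / 4 / ‖x₀ - z‖), by positivity,
      (min_le_left _ _).trans_lt (by norm_num), ?_⟩
    calc _ ≤ (r / 4 / ‖x₀ - z‖) * ‖x₀ - z‖ := by gcongr; exact min_le_right _ _
      _ = r / 4 := div_mul_cancel₀ _ hpos.ne'
      _ < r / 2 := by linarith
  have hz' : z ∈ interior Ω := by rwa [hΩ.isOpen.interior_eq]
  have ha : x₀ - θ • (x₀ - z) ∈ Ω := by
    have := hΩ.convex.combo_closure_interior_mem_interior (frontier_subset_closure hx₀) hz'
      (show 0 ≤ 1 - θ by linarith) hθ0 (by ring)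
    rw [hΩ.isOpen.interior_eq] at this
    rwa [show x₀ - θ • (x₀ - z) = (1 - θ) • x₀ + θ • z by module]
  have hb : x₀ + θ • (x₀ - z) ∈ (closure Ω)ᶜ := by
    intro hcon
    have := hΩ.convex.combo_closure_interior_mem_interior hcon hz'
      (show 0 ≤ 1 / (1 + θ) by positivity) (show 0 < θ / (1 + θ) by positivity) (by field_simp)
    rw [hΩ.isOpen.interior_eq] at this
    refine hx₀' ?_
    rwa [show (1 / (1 + θ)) • (x₀ + θ • (x₀ - z)) + (θ / (1 + θ)) • z =
      ((1 + θ) / (1 + θ)) • x₀ by module, div_self (by linarith), one_smul] at this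
  obtain ⟨η₁, hη₁, hball₁⟩ := Metric.isOpen_iff.1 hΩ.isOpen _ ha
  obtain ⟨η₂, hη₂, hball₂⟩ := Metric.isOpen_iff.1 isClosed_closure.isOpen_compl _ hb
  set η := min (min η₁ η₂) (r / 2) with hη
  have hη0 : 0 < η := by positivity
  have hsub : Metric.ball ((ℝ ∙ e)ᗮ.orthogonalProjectionOnto x₀) η ⊆
      (ℝ ∙ e)ᗮ.orthogonalProjectionOnto '' (U ∩ frontier Ω) := by
    intro y hy
    rw [mem_ball_iff_norm] at hy
    set v : (ℝ ∙ e)ᗮ := y - (ℝ ∙ e)ᗮ.orthogonalProjectionOnto x₀ with hv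
    have hvn : ‖(v : EuclideanSpace ℝ (Fin n))‖ < η := hy
    have h1 : x₀ - θ • (x₀ - z) + v ∈ Ω := hball₁ (by
      rw [mem_ball_iff_norm, add_sub_cancel_left]
      exact hvn.trans_le ((min_le_left _ _).trans (min_le_left _ _)))
    have h2 : x₀ + θ • (x₀ - z) + v ∉ Ω := fun h => hball₂ (by
      rw [mem_ball_iff_norm, add_sub_cancel_left]
      exact hvn.trans_le ((min_le_left _ _).trans (min_le_right _ _))) (subset_closure h)
    obtain ⟨q, ⟨α, β, hα, hβ, hαβ, rfl⟩, hq⟩ := exists_mem_segment_frontier hΩ.isOpen h1 h2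
    have hqeq : α • (x₀ - θ • (x₀ - z) + (v : EuclideanSpace ℝ (Fin n))) +
        β • (x₀ + θ • (x₀ - z) + (v : EuclideanSpace ℝ (Fin n))) =
        x₀ + v + ((β - α) * θ) • (x₀ - z) := by
      rw [show α = 1 - β by linarith]; module
    rw [hqeq] at hq
    refine ⟨_, ⟨hball ?_, hq⟩, ?_⟩
    · rw [mem_ball_iff_norm, add_assoc, add_sub_cancel_left]
      refine (norm_add_le _ _).trans_lt ?_
      have h3 : ‖((β - α) * θ) • (x₀ - z)‖ ≤ θ * ‖x₀ - z‖ := by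
        rw [norm_smul, norm_mul, Real.norm_of_nonneg hθ0.le]
        have : ‖β - α‖ ≤ 1 := by rw [Real.norm_eq_abs, abs_le]; constructor <;> linarith
        have h4 : 0 ≤ θ * ‖x₀ - z‖ := by positivity
        nlinarith
      have h5 : η ≤ r / 2 := min_le_right _ _
      linarith
    · have h6 : (ℝ ∙ e)ᗮ.orthogonalProjectionOnto (x₀ - z) = 0 := by
        refine Subtype.ext ?_
        rw [orthogonalProjectionOnto_coe_eq henorm]
        have : x₀ - z = ‖x₀ - z‖ • e := by
          rw [he, smul_smul, mul_inv_cancel₀ hpos.ne', one_smul]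
        rw [this, real_inner_smul_left, real_inner_self_eq_norm_sq, henorm]
        simp
      rw [map_add, map_add, map_smul, h6, smul_zero, add_zero,
        Submodule.orthogonalProjectionOnto_mem_subspace_eq_self, hv, add_sub_cancel]
  have hl := ((ℝ ∙ e)ᗮ.lipschitzWith_orthogonalProjectionOnto.lipschitzOnWith
    (s := U ∩ frontier Ω)).euclideanHausdorffMeasure_image_le (n - 1)
  simp only [ENNReal.coe_one, one_pow, one_mul] at hl
  refine lt_of_lt_of_le ?_ ((measure_mono hsub).trans hl)
  rw [← finrank_orthogonal_span_singleton_eq henorm,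
    InnerProductSpace.euclideanHausdorffMeasure_eq_volume]
  exact Metric.measure_ball_pos _ _ hη0

theorem IsFinslerNorm.weightedPerimeter_pos (hF : IsFinslerNorm p F) (hΩ : IsConvexDomain Ω)
    {w : ℝ → ℝ} (hw : Continuous w) (hw0 : ∀ x ∈ frontier Ω, 0 ≤ w (polar F x))
    {x₀ : EuclideanSpace ℝ (Fin n)} (hx₀ : x₀ ∈ frontier Ω) (hwx : 0 < w (polar F x₀)) :
    0 < weightedPerimeter F w Ω := by
  have hm : MeasurableSet (frontier Ω) := isClosed_frontier.measurableSet
  have hnn : ∀ x ∈ frontier Ω, 0 ≤ w (polar F x) * F (outwardNormal Ω x) := fun x hx =>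
    mul_nonneg (hw0 x hx) (hF.nonneg _)
  refine lt_of_le_of_ne (setIntegral_nonneg hm hnn) fun h0 => ?_
  have h1 := (setIntegral_eq_zero_iff_of_nonneg_ae
    ((ae_restrict_iff' hm).2 (Filter.Eventually.of_forall hnn))
    (hF.integrableOn_weight hΩ hw)).1 h0.symm
  have hU : IsOpen {x | 0 < w (polar F x)} :=
    isOpen_lt continuous_const (hw.comp hF.continuous_polar)
  refine (hΩ.euclideanHausdorffMeasure_inter_frontier_pos hU hx₀ hwx).ne' ?_
  have h2 : ∀ᵐ x ∂(μHE[n - 1] : Measure (EuclideanSpace ℝ (Fin n))).restrict (frontier Ω),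
      x ∉ {x | 0 < w (polar F x)} := by
    filter_upwards [h1, hΩ.ae_norm_outwardNormal] with x hx1 hx2 hx3
    have h4 : outwardNormal Ω x ≠ 0 := by
      intro h; rw [h, norm_zero] at hx2; exact zero_ne_one hx2
    exact (mul_pos hx3 (hF.map_pos h4)).ne' hx1
  rw [ae_restrict_iff' hm] at h2
  refine measure_mono_null (fun x hx => ?_) h2
  exact fun h => h hx.2 hx.1

theorem IsConvexDomain.frontier_nonempty (hn : 1 ≤ n) (hΩ : IsConvexDomain Ω) :
    (frontier Ω).Nonempty := by
  have : Nontrivial (EuclideanSpace ℝ (Fin n)) :=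
    Module.nontrivial_of_finrank_pos (R := ℝ) (by rw [finrank_euclideanSpace_fin]; omega)
  refine nonempty_frontier_iff.2 ⟨hΩ.nonempty, fun h => ?_⟩
  exact NormedSpace.unbounded_univ ℝ (EuclideanSpace ℝ (Fin n)) (h ▸ hΩ.isBounded)

theorem IsFinslerNorm.anisotropicPerimeter_pos (hF : IsFinslerNorm p F) (hn : 1 ≤ n)
    (hΩ : IsConvexDomain Ω) : 0 < anisotropicPerimeter F Ω := by
  obtain ⟨x, hx⟩ := hΩ.frontier_nonempty hn
  rw [anisotropicPerimeter_eq]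
  exact hF.weightedPerimeter_pos hΩ continuous_const (fun _ _ => zero_le_one) hx one_pos

theorem IsFinslerNorm.weightedPerimeter_sub (hF : IsFinslerNorm p F) (hΩ : IsConvexDomain Ω)
    {w : ℝ → ℝ} (hw : Continuous w) (c : ℝ) :
    weightedPerimeter F (fun t => w t - c) Ω =
      weightedPerimeter F w Ω - c * anisotropicPerimeter F Ω := by
  rw [anisotropicPerimeter, weightedPerimeter, weightedPerimeter, ← integral_const_mul,
    ← integral_sub (hF.integrableOn_weight hΩ hw)]
  · simp only [sub_mul]
  · exact hF.integrableOn_weight hΩ (w := fun _ => c) continuous_const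

theorem vol_pos (hΩ : IsConvexDomain Ω) : 0 < vol Ω :=
  ENNReal.toReal_pos (hΩ.isOpen.measure_pos volume hΩ.nonempty).ne' hΩ.isBounded.measure_lt_top.ne

/-! ### The maximal radius -/

theorem IsFinslerNorm.polar_le_rMax (hF : IsFinslerNorm p F) (hΩ : IsConvexDomain Ω)
    {x : EuclideanSpace ℝ (Fin n)} (hx : x ∈ closure Ω) : polar F x ≤ rMax F Ω :=
  le_csSup (hΩ.isBounded.isCompact_closure.bddAbove_image hF.continuous_polar.continuousOn)
    (mem_image_of_mem _ hx)

theorem IsFinslerNorm.exists_polar_eq_rMax (hF : IsFinslerNorm p F) (hΩ : IsConvexDomain Ω) :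
    ∃ x ∈ closure Ω, polar F x = rMax F Ω := by
  obtain ⟨x, hx, h⟩ := hΩ.isBounded.isCompact_closure.exists_sSup_image_eq hΩ.nonempty.closure
    hF.continuous_polar.continuousOn
  exact ⟨x, hx, h.symm⟩

theorem IsFinslerNorm.rMax_pos (hF : IsFinslerNorm p F) (hn : 1 ≤ n) (hΩ : IsConvexDomain Ω) :
    0 < rMax F Ω := by
  by_contra! hcon
  have h1 : ∀ x ∈ closure Ω, x = 0 := by
    intro x hx
    by_contra h0
    linarith [hF.polar_pos h0, hF.polar_le_rMax hΩ hx]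
  obtain ⟨x, hx⟩ := hΩ.frontier_nonempty hn
  obtain ⟨y, hy⟩ := hΩ.nonempty
  have h2 := h1 x (frontier_subset_closure hx)
  rw [← h1 y (subset_closure hy)] at h2
  rw [hΩ.isOpen.frontier_eq] at hx
  exact hx.2 (h2 ▸ hy)

theorem IsFinslerNorm.polar_lt_rMax (hF : IsFinslerNorm p F) (hn : 1 ≤ n) (hΩ : IsConvexDomain Ω)
    {x : EuclideanSpace ℝ (Fin n)} (hx : x ∈ Ω) : polar F x < rMax F Ω := by
  rcases eq_or_ne x 0 with rfl | hx0
  · rw [IsFinslerNorm.polar_zero]; exact hF.rMax_pos hn hΩ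
  obtain ⟨τ, hτ, hmem⟩ := hΩ.exists_smul_mem_frontier hx hx0
  have h1 := hF.polar_le_rMax hΩ (frontier_subset_closure hmem)
  rw [IsFinslerNorm.polar_smul (by linarith)] at h1
  nlinarith [hF.polar_pos hx0]

/-- A domain other than the Wulff shape of radius `rMax` has a boundary point at a smaller level. -/
theorem IsFinslerNorm.exists_frontier_polar_lt (hF : IsFinslerNorm p F) (hn : 1 ≤ n)
    (hΩ : IsConvexDomain Ω) (hne : Ω ≠ wulffShape F (rMax F Ω) 0) :
    ∃ x ∈ frontier Ω, polar F x < rMax F Ω := by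
  have hsub : Ω ⊆ wulffShape F (rMax F Ω) 0 := fun x hx => by
    rw [wulffShape_zero]; exact hF.polar_lt_rMax hn hΩ hx
  obtain ⟨y, hy, hyΩ⟩ := not_subset.1 fun h => hne (hsub.antisymm h)
  obtain ⟨x, hx⟩ := hΩ.nonempty
  obtain ⟨z, hz, hzf⟩ := exists_mem_segment_frontier hΩ.isOpen hx hyΩ
  have h := (hF.isConvexDomain_wulffShape (hF.rMax_pos hn hΩ)).convex.segment_subset
    (hsub hx) hy hz
  rw [wulffShape_zero] at h
  exact ⟨z, hzf, h⟩

/-- Outside of Wulff shapes the mean of `F° ^ p` over the boundary is below its maximum. -/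
theorem IsFinslerNorm.boundaryMomentum_lt (hF : IsFinslerNorm p F) (hp : 0 < p) (hn : 1 ≤ n)
    (hΩ : IsConvexDomain Ω) (hne : Ω ≠ wulffShape F (rMax F Ω) 0) :
    boundaryMomentum p F Ω < rMax F Ω ^ p * anisotropicPerimeter F Ω := by
  obtain ⟨x, hx, hxR⟩ := hF.exists_frontier_polar_lt hn hΩ hne
  have hc : Continuous fun t : ℝ => -t ^ p := (Real.continuous_rpow_const hp.le).neg
  have h1 := hF.weightedPerimeter_pos hΩ (w := fun t => -t ^ p - -rMax F Ω ^ p)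
    (hc.sub continuous_const) (fun y hy => by
      have := Real.rpow_le_rpow (hF.polar_nonneg y)
        (hF.polar_le_rMax hΩ (frontier_subset_closure hy)) hp.le
      linarith) hx (by
      have := Real.rpow_lt_rpow (hF.polar_nonneg x) hxR hp
      linarith)
  rw [hF.weightedPerimeter_sub hΩ hc] at h1
  have h2 : weightedPerimeter F (fun t => -t ^ p) Ω = -boundaryMomentum p F Ω := by
    rw [boundaryMomentum_eq, weightedPerimeter, weightedPerimeter, ← integral_neg]
    simp only [neg_mul]
  rw [h2] at h1
  linarith

end Positivity

/-! ### Comparison with the cut domain -/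

section Comparison

variable {n : ℕ} {p : ℝ} {F : EuclideanSpace ℝ (Fin n) → ℝ} {Ω : Set (EuclideanSpace ℝ (Fin n))}

/-- Integrated divergence bound for the weight `t ^ p - c`; both summands reduce to Bernoulli's
inequality for `(b / s) ^ n`. -/
theorem pow_mul_rpow_sub_le (hn : 1 ≤ n) (hp : 1 ≤ p) {s b c : ℝ} (hs : 0 < s) (hsb : s ≤ b)
    (hc : 0 ≤ c) :
    s ^ (n - 1) * (s ^ p - c) +
      ((n + p - 1) * s ^ (p - 1) - c * (n - 1) / s) * ((b ^ n - s ^ n) / n) ≤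
    b ^ (n - 1) * (b ^ p - c) := by
  obtain ⟨x, rfl⟩ : ∃ x, b = x * s := ⟨b / s, (div_mul_cancel₀ _ hs.ne').symm⟩
  have hx : 1 ≤ x := by
    by_contra! h; nlinarith
  have hx0 : 0 < x := by linarith
  obtain ⟨m, rfl⟩ : ∃ m, n = m + 1 := ⟨n - 1, by omega⟩
  rw [Nat.add_sub_cancel, Real.mul_rpow hx0.le hs.le, Real.rpow_sub_one hs.ne']
  have hT : 0 < s ^ p := Real.rpow_pos_of_pos hs p
  set T := s ^ p
  have hm : (0 : ℝ) < ((m + 1 : ℕ) : ℝ) := by positivity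
  have hy : -1 ≤ x ^ (m + 1) - 1 := by linarith [pow_pos hx0 (m + 1)]
  have hpow : ∀ α : ℝ, (x ^ (m + 1)) ^ (α / ((m + 1 : ℕ) : ℝ)) = x ^ α := by
    intro α
    rw [← Real.rpow_natCast, ← Real.rpow_mul hx0.le, mul_div_cancel₀ _ hm.ne']
  have h1 : 1 + (m + p) / ((m + 1 : ℕ) : ℝ) * (x ^ (m + 1) - 1) ≤ x ^ m * x ^ p := by
    have := one_add_mul_self_le_rpow_one_add hy (p := (m + p) / ((m + 1 : ℕ) : ℝ))
      ((one_le_div hm).2 (by push_cast; linarith))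
    rwa [add_sub_cancel, hpow, Real.rpow_add hx0, Real.rpow_natCast] at this
  have h2 : x ^ m ≤ 1 + m / ((m + 1 : ℕ) : ℝ) * (x ^ (m + 1) - 1) := by
    have := rpow_one_add_le_one_add_mul_self hy (p := m / ((m + 1 : ℕ) : ℝ))
      (by positivity) ((div_le_one hm).2 (by push_cast; linarith))
    rwa [add_sub_cancel, hpow, Real.rpow_natCast] at this
  have h3 : T * (1 + (m + p) / ((m + 1 : ℕ) : ℝ) * (x ^ (m + 1) - 1)) - c *
      (1 + m / ((m + 1 : ℕ) : ℝ) * (x ^ (m + 1) - 1)) ≤ T * (x ^ m * x ^ p) - c * x ^ m := by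
    nlinarith
  calc _ = s ^ m * (T * (1 + (m + p) / ((m + 1 : ℕ) : ℝ) * (x ^ (m + 1) - 1)) - c *
      (1 + m / ((m + 1 : ℕ) : ℝ) * (x ^ (m + 1) - 1))) := by
        push_cast
        field_simp
        ring
    _ ≤ s ^ m * (T * (x ^ m * x ^ p) - c * x ^ m) := by gcongr
    _ = _ := by rw [mul_pow]; ring

theorem one_sub_rpow_le {x q : ℝ} (hx : 0 < x) (hq : 0 ≤ q) : 1 - x ^ q ≤ q * (x⁻¹ - 1) := by
  have h1 := Real.add_one_le_exp (Real.log x * q)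
  rw [← Real.rpow_def_of_pos hx] at h1
  have h2 := Real.one_sub_inv_le_log_of_pos hx
  nlinarith

/-- First-order consequence of minimality under cutting with the Wulff shape of radius `s`. The
number `c` is the mean of `F° ^ p` over the boundary with respect to anisotropic perimeter. -/
theorem IsMinimizer.mul_vol_le (hF : IsFinslerNorm p F) (hp : 1 < p) (hn : 1 ≤ n)
    (hmin : IsMinimizer p F Ω) {s c : ℝ} (hs : 0 < s) (hsR : s < rMax F Ω)
    (hne : (Ω ∩ wulffShape F s 0).Nonempty) (hc0 : 0 ≤ c) (hcs : c ≤ s ^ p)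
    (hc : boundaryMomentum p F Ω = c * anisotropicPerimeter F Ω) :
    ((n + p - 1) * s ^ (p - 1) - c * (n - 1) / s) * vol (Ω ∩ wulffShape F s 0) ≤
      p / n * boundaryMomentum p F Ω := by
  have hΩ := hmin.1
  have hn0 : (0 : ℝ) < n := by exact_mod_cast hn
  have hn1 : (1 : ℝ) ≤ n := by exact_mod_cast hn
  set K := Ω ∩ wulffShape F s 0 with hKdef
  set D := Ω ∩ {x | s ≤ polar F x} with hDdef
  set κ := (n + p - 1) * s ^ (p - 1) - c * (n - 1) / s with hκdef
  have hK : IsConvexDomain K := hF.isConvexDomain_inter_wulffShape hΩ hs hne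
  have hκ : 0 ≤ κ := by
    have h1 : c * (n - 1) / s ≤ s ^ (p - 1) * (n - 1) := by
      rw [Real.rpow_sub_one hs.ne', div_mul_eq_mul_div]
      gcongr
    have h2 : 0 ≤ s ^ (p - 1) := Real.rpow_nonneg hs.le _
    rw [hκdef]
    nlinarith
  have hpc : Continuous fun t : ℝ => t ^ p := Real.continuous_rpow_const (by linarith)
  have hVK : 0 < vol K := vol_pos hK
  have hV : 0 < vol Ω := vol_pos hΩ
  have hP : 0 < anisotropicPerimeter F Ω := hF.anisotropicPerimeter_pos hn hΩ
  have hPK : 0 < anisotropicPerimeter F K := hF.anisotropicPerimeter_pos hn hK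
  -- the momentum and the perimeter of the cut domain
  have hM : boundaryMomentum p F K - c * anisotropicPerimeter F K ≤ -(κ * vol D) := by
    have h := hF.weightedPerimeter_inter_wulffShape_le hn hΩ hs hne hκ
      (w := fun t => t ^ p - c) (hpc.sub continuous_const) (sub_nonneg.2 hcs)
      fun x _ hsx => pow_mul_rpow_sub_le hn hp.le hs hsx.le hc0
    rw [hF.weightedPerimeter_sub hK hpc, hF.weightedPerimeter_sub hΩ hpc, ← boundaryMomentum_eq,
      ← boundaryMomentum_eq, hc, sub_self, zero_sub] at h
    exact h
  have hPle : anisotropicPerimeter F K ≤ anisotropicPerimeter F Ω := by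
    have h := hF.weightedPerimeter_inter_wulffShape_le hn hΩ hs hne le_rfl
      (w := fun _ => 1) continuous_const zero_le_one fun x _ hsx => by
        rw [zero_mul, add_zero, mul_one, mul_one]
        exact pow_le_pow_left₀ hs.le hsx.le _
    rw [zero_mul, sub_zero] at h
    rwa [anisotropicPerimeter_eq, anisotropicPerimeter_eq]
  have hD : vol K + vol D = vol Ω := by
    have hm : MeasurableSet (wulffShape F s 0) := (hF.isOpen_wulffShape s).measurableSet
    have hDe : D = Ω \ wulffShape F s 0 := by
      ext x
      rw [wulffShape_zero]
      simp [hDdef]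
    have h := measure_inter_add_sdiff (μ := volume) Ω hm
    have hfin := hΩ.isBounded.measure_lt_top (μ := volume)
    rw [vol, vol, vol, hDe, hKdef, ← ENNReal.toReal_add
      ((measure_mono inter_subset_left).trans_lt hfin).ne
      ((measure_mono sdiff_subset).trans_lt hfin).ne, h]
  have hDpos : 0 < vol D := by
    obtain ⟨x, hx, hxR⟩ := hF.exists_polar_eq_rMax hΩ
    have hO : IsOpen {x | s < polar F x} := isOpen_lt continuous_const hF.continuous_polar
    obtain ⟨y, hy, hyΩ⟩ := mem_closure_iff.1 hx _ hO (by
      change s < polar F x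
      rwa [hxR])
    have hpos := (hΩ.isOpen.inter hO).measure_pos volume ⟨y, hyΩ, hy⟩
    refine ENNReal.toReal_pos (hpos.trans_le (measure_mono ?_)).ne'
      (hΩ.isBounded.subset inter_subset_left).measure_lt_top.ne
    exact inter_subset_inter_right _ fun z (hz : s < polar F z) => hz.le
  -- minimality
  have hle := hmin.2 K hK
  set q := p / (n : ℝ) with hq
  have hq0 : 0 ≤ q := by positivity
  have hVq : 0 < vol Ω ^ q := Real.rpow_pos_of_pos hV q
  have hVKq : 0 < vol K ^ q := Real.rpow_pos_of_pos hVK q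
  have h1 : c * anisotropicPerimeter F K * (vol K / vol Ω) ^ q ≤ boundaryMomentum p F K := by
    have e : c * anisotropicPerimeter F Ω / (anisotropicPerimeter F Ω * vol Ω ^ q) =
        c / vol Ω ^ q := by field_simp
    rw [functional, functional, ← hq, hc, e, le_div_iff₀ (by positivity)] at hle
    rw [Real.div_rpow hVK.le hV.le]
    calc _ = c / vol Ω ^ q * (anisotropicPerimeter F K * vol K ^ q) := by ring
      _ ≤ _ := hle
  have h2 : κ * vol D ≤ c * anisotropicPerimeter F K * (1 - (vol K / vol Ω) ^ q) := by
    linarith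
  have h3 := one_sub_rpow_le (div_pos hVK hV) hq0
  have h4 : (vol K / vol Ω)⁻¹ - 1 = vol D / vol K := by
    rw [inv_div, ← hD]; field_simp; ring
  rw [h4] at h3
  have h5 : κ * vol D ≤ c * anisotropicPerimeter F Ω * (q * (vol D / vol K)) := by
    refine h2.trans ((mul_le_mul_of_nonneg_left h3 (by positivity)).trans ?_)
    gcongr
  rw [← hc] at h5
  have h6 : κ * vol K * vol D ≤ q * boundaryMomentum p F Ω * vol D := by
    calc κ * vol K * vol D = (κ * vol D) * vol K := by ring
      _ ≤ (boundaryMomentum p F Ω * (q * (vol D / vol K))) * vol K := by gcongr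
      _ = _ := by field_simp
  exact le_of_mul_le_mul_right h6 hDpos

end Comparison

end AnisotropicMomentum

theorem mainTheorem4 (n : ℕ) (hn : 2 ≤ n) (p : ℝ) (hp : 1 < p)
    (F : EuclideanSpace ℝ (Fin n) → ℝ) (hF : AnisotropicMomentum.IsFinslerNorm p F)
    (Ω : Set (EuclideanSpace ℝ (Fin n))) (hΩ : AnisotropicMomentum.IsConvexDomain Ω)
    (hE : AnisotropicMomentum.excess p F Ω = 0) :
    (∃ r : ℝ, 0 < r ∧ Ω = AnisotropicMomentum.wulffShape F r 0) ∨
      ¬ AnisotropicMomentum.IsMinimizer p F Ω := by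
  open AnisotropicMomentum in
  have hn1 : 1 ≤ n := by omega
  have hn2 : (2 : ℝ) ≤ n := by exact_mod_cast hn
  set R := rMax F Ω with hRdef
  have hR : 0 < R := hF.rMax_pos hn1 hΩ
  by_cases hW : Ω = wulffShape F R 0
  · exact Or.inl ⟨R, hR, hW⟩
  refine Or.inr fun hmin => ?_
  set M := boundaryMomentum p F Ω with hMdef
  set P := anisotropicPerimeter F Ω with hPdef
  have hP : 0 < P := hF.anisotropicPerimeter_pos hn1 hΩ
  have hV : 0 < vol Ω := vol_pos hΩ
  have hMeq : M = n * vol Ω * R ^ (p - 1) := by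
    have h : R ^ (p - 1) - M / (n * vol Ω) = 0 := hE
    rw [sub_eq_zero.1 h]; field_simp
  set c := M / P with hcdef
  have hc : M = c * P := (div_mul_cancel₀ _ hP.ne').symm
  have hcR : c < R ^ p := by
    rw [hcdef, div_lt_iff₀ hP]
    exact hF.boundaryMomentum_lt (by linarith) hn1 hΩ hW
  have hc0 : 0 ≤ c := by
    have := Real.rpow_nonneg hR.le (p - 1)
    rw [hcdef, hMeq]
    positivity
  obtain ⟨x₁, hx₁⟩ := hΩ.nonempty
  have hx₁R : polar F x₁ < R := hF.polar_lt_rMax hn1 hΩ hx₁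
  obtain ⟨u, hu, huR, hlim⟩ := exists_seq_strictMono_tendsto' hx₁R
  have hu0 : ∀ k, 0 < u k := fun k => (hF.polar_nonneg x₁).trans_lt (huR k).1
  have hpc : Filter.Tendsto (fun k => u k ^ p) Filter.atTop (nhds (R ^ p)) :=
    hlim.rpow_const (Or.inl hR.ne')
  -- for `k` large enough, `u k` satisfies the condition `c ≤ s ^ p` on the cutting radius `s`
  have hev : ∀ᶠ k in Filter.atTop,
      ((n + p - 1) * u k ^ (p - 1) - c * (n - 1) / u k) * vol (Ω ∩ wulffShape F (u k) 0) ≤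
        p / n * M := by
    filter_upwards [hpc.eventually_const_lt hcR] with k hk
    refine hmin.mul_vol_le hF hp hn1 (hu0 k) (huR k).2 ⟨x₁, hx₁, ?_⟩ hc0 hk.le hc
    rw [wulffShape_zero]
    exact (huR k).1
  -- the cut domains exhaust `Ω`
  have hvol : Filter.Tendsto (fun k => vol (Ω ∩ wulffShape F (u k) 0)) Filter.atTop
      (nhds (vol Ω)) := by
    have hmono : Monotone fun k => Ω ∩ wulffShape F (u k) 0 := by
      intro i j hij
      refine inter_subset_inter_right _ fun x hx => ?_
      rw [wulffShape_zero] at hx ⊢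
      exact lt_of_lt_of_le hx (hu.monotone hij)
    have hun : ⋃ k, Ω ∩ wulffShape F (u k) 0 = Ω := by
      refine Set.Subset.antisymm (iUnion_subset fun k => inter_subset_left) fun x hx => ?_
      obtain ⟨k, hk⟩ := (hlim.eventually_const_lt (hF.polar_lt_rMax hn1 hΩ hx)).exists
      exact mem_iUnion.2 ⟨k, hx, by rw [wulffShape_zero]; exact hk⟩
    have h := tendsto_measure_iUnion_atTop (μ := volume) hmono
    rw [hun] at h
    exact (ENNReal.tendsto_toReal hΩ.isBounded.measure_lt_top.ne).comp h
  have hκlim : Filter.Tendsto (fun k => (n + p - 1) * u k ^ (p - 1) - c * (n - 1) / u k)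
      Filter.atTop (nhds ((n + p - 1) * R ^ (p - 1) - c * (n - 1) / R)) :=
    ((hlim.rpow_const (Or.inl hR.ne')).const_mul _).sub (tendsto_const_nhds.div hlim hR.ne')
  have hfin := le_of_tendsto (hκlim.mul hvol) hev
  -- in the limit `c ≥ R ^ p`
  have hn0 : (n : ℝ) ≠ 0 := by positivity
  rw [hMeq, show p / n * (n * vol Ω * R ^ (p - 1)) = (p * R ^ (p - 1)) * vol Ω by
    field_simp] at hfin
  have h1 := le_of_mul_le_mul_right hfin hV
  have h2 : (n - 1) * R ^ p ≤ (n - 1) * c := by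
    rw [Real.rpow_sub_one hR.ne'] at h1
    have h3 : ((n + p - 1) * (R ^ p / R) - c * (n - 1) / R) * R ≤ p * (R ^ p / R) * R := by
      gcongr
    have h4 : ((n + p - 1) * (R ^ p / R) - c * (n - 1) / R) * R =
        (n + p - 1) * R ^ p - c * (n - 1) := by field_simp
    have h5 : p * (R ^ p / R) * R = p * R ^ p := by field_simp
    rw [h4, h5] at h3
    linarith
  -- cancelling `n - 1` needs `n ≥ 2`
  have h3 := le_of_mul_le_mul_left h2 (by linarith : (0 : ℝ) < n - 1)
  linarith
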